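/- Let $n\ge 2$, let $\mathbb D$ be the open unit disc, $\mathbb T=\partial\mathbb D$, and let $m_n$ be the normalized Lebesgue measure on $\mathbb T^n$. Put $C(z,\zeta)=\prod_{j=1}^n (1-z_j\overline{\zeta_j})^{-1}$ and $P(z,\zeta)=C(z,\zeta)C(\zeta,z)/C(z,z)$ for $z\in\mathbb D^n$, $\zeta\in\mathbb T^n$. Let $I:\mathbb D^n\to\mathbb D$ be an inner function, that is, $I$ is holomorphic and for $m_n$-a.e. $\zeta\in\mathbb T^n$ the radial limit $I(\zeta)=\lim_{r\to1-}I(r\zeta)$ exists and has modulus $1$. Let $\alpha\in\mathbb T$, and let $\sigma_\alpha$ be the Clark measure of $I$ at $\alpha$: the unique finite positive Borel measure on $\mathbb T^n$ with $$\int_{\mathbb T^n}P(z,\zeta)\,d\sigma_\alpha(\zeta)=\operatorname{Re}\frac{\alpha+I(z)}{\alpha-I(z)},\qquad z\in\mathbb D^n.$$ Let $H^2$ be the space of holomorphic functions $f$ on $\mathbb D^n$ with $\sup_{0<r<1}\int_{\mathbb T^n}|f(r\zeta)|^2\,dm_n(\zeta)<\infty$, identified with the subspace of $L^2(m_n)$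 formed by their radial boundary values, and let $H^2\ominus IH^2$ be the orthogonal complement of $IH^2$ in $H^2$. Let $T_\alpha: H^2\ominus IH^2\to L^2(\sigma_\alpha)$ be the unique isometric linear operator such that, for every $w\in\mathbb D^n$, $T_\alpha$ maps the reproducing kernel $K_w(z)=(1-I(z)\overline{I(w)})\,C(z,w)$ to the function $\xi\mapsto(1-\alpha\overline{I(w)})\,C(\xi,w)$. Finally, let $A(\mathbb D^n)$ be the polydisc algebra of all continuous functions on $\overline{\mathbb D}^n$ that are holomorphic in $\mathbb D^n$. Then the following properties are equivalent: (i) $T_\alpha$ is a unitary operator (that is, an isometric linear operator onto $L^2(\sigma_\alpha)$); (ii) for every nonzero $f\in L^2(\sigma_\alpha)$, the Cauchy transform $(f\sigma_\alpha)_+(z)=\int_{\mathbb T^n}C(z,\xi)f(\xi)\,d\sigma_\alpha(\xi)$, $z\in\mathbb D^n$, is not identically zero; (iii) $A(\mathbb D^n)$, restricted to $\mathbb T^n$, is dense in $L^2(\sigma_\alpha)$. -/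

import Mathlib

open MeasureTheory Filter Topology
open scoped ENNReal ComplexConjugate InnerProductSpace

namespace PolydiscClark

/-- The open unit polydisc `𝔻ⁿ` in `ℂⁿ`. -/
def polydisc (n : ℕ) : Set (Fin n → ℂ) := {z | ∀ j, ‖z j‖ < 1}

/-- The closed unit polydisc in `ℂⁿ`. -/
def closedPolydisc (n : ℕ) : Set (Fin n → ℂ) := {z | ∀ j, ‖z j‖ ≤ 1}

/-- The torus `𝕋ⁿ`, each circle `𝕋` being parametrized by `ℝ/ℤ` through the homeomorphism
`t ↦ exp (2πit)`; the corresponding point of `ℂⁿ` is `torusPoint`. -/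
abbrev Torus (n : ℕ) : Type := UnitAddTorus (Fin n)

/-- The point `(exp (2πi t₁), …, exp (2πi tₙ))` of `ℂⁿ`. -/
noncomputable def torusPoint {n : ℕ} (t : Torus n) : Fin n → ℂ :=
  fun j => (AddCircle.toCircle (t j) : ℂ)

/-- The normalized Lebesgue measure on the torus. -/
noncomputable def torusMeasure (n : ℕ) : Measure (Torus n) :=
  Measure.pi fun _ => (AddCircle.haarAddCircle : Measure UnitAddCircle)

/-- The Cauchy kernel `C(z, ζ) = ∏ⱼ 1 / (1 - zⱼ conj ζⱼ)`. -/
noncomputable def cauchyKernel {n : ℕ} (z ζ : Fin n → ℂ) : ℂ :=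
  ∏ j, 1 / (1 - z j * conj (ζ j))

/-- The Poisson kernel `P(z, ζ) = C(z, ζ) C(ζ, z) / C(z, z)`. -/
noncomputable def polydiscPoissonKernel {n : ℕ} (z ζ : Fin n → ℂ) : ℂ :=
  cauchyKernel z ζ * cauchyKernel ζ z / cauchyKernel z z

/-- The Cauchy transform `(f σ)₊` of the complex measure `f σ`. -/
noncomputable def cauchyTransform {n : ℕ} (σ : Measure (Torus n)) (f : Torus n → ℂ)
    (z : Fin n → ℂ) : ℂ :=
  ∫ ξ, cauchyKernel z (torusPoint ξ) * f ξ ∂σ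

/-- `F` is the function of radial boundary values `lim_{r → 1-} f (r ζ)` of `f`,
almost everywhere on the torus. -/
def HasBoundaryValues {n : ℕ} (f : (Fin n → ℂ) → ℂ) (F : Torus n → ℂ) : Prop :=
  ∀ᵐ ζ ∂(torusMeasure n),
    Tendsto (fun r : ℝ => f ((r : ℂ) • torusPoint ζ)) (𝓝[<] 1) (𝓝 (F ζ))

/-- Inner functions: holomorphic functions `𝔻ⁿ → 𝔻` whose radial boundary values exist and are
unimodular almost everywhere. -/
structure IsInner {n : ℕ} (I : (Fin n → ℂ) → ℂ) : Prop where
  holomorphic : DifferentiableOn ℂ I (polydisc n)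
  norm_lt_one : ∀ z ∈ polydisc n, ‖I z‖ < 1
  unimodular : ∀ᵐ ζ ∂(torusMeasure n), ∃ c : ℂ, ‖c‖ = 1 ∧
    Tendsto (fun r : ℝ => I ((r : ℂ) • torusPoint ζ)) (𝓝[<] 1) (𝓝 c)

/-- The Hardy class `H²(𝔻ⁿ)`: holomorphic functions whose `L²` norms over the tori `r 𝕋ⁿ`,
`0 < r < 1`, are bounded. -/
def MemHardy {n : ℕ} (f : (Fin n → ℂ) → ℂ) : Prop :=
  DifferentiableOn ℂ f (polydisc n) ∧
    ∃ M : ℝ≥0∞, M < ∞ ∧ ∀ r : ℝ, 0 < r → r < 1 →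
      ∫⁻ ζ, ‖f ((r : ℂ) • torusPoint ζ)‖ₑ ^ 2 ∂(torusMeasure n) ≤ M

theorem MemHardy.zero {n : ℕ} : MemHardy (fun _ : Fin n → ℂ => (0 : ℂ)) :=
  ⟨differentiableOn_const _, 0, by simp, by simp⟩

theorem MemHardy.smul {n : ℕ} {f : (Fin n → ℂ) → ℂ} (hf : MemHardy f) (c : ℂ) :
    MemHardy (fun z => c * f z) := by
  obtain ⟨hd, M, hM, h⟩ := hf
  refine ⟨hd.const_mul c, ‖c‖ₑ ^ 2 * M, ENNReal.mul_lt_top (by simp) hM, fun r h0 h1 => ?_⟩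
  simp only [enorm_mul, mul_pow]
  rw [lintegral_const_mul' _ _ (by simp)]
  gcongr
  exact h r h0 h1

theorem continuous_torusPoint {n : ℕ} : Continuous (torusPoint (n := n)) :=
  continuous_pi fun j =>
    continuous_subtype_val.comp (AddCircle.continuous_toCircle.comp (continuous_apply j))

theorem smul_torusPoint_mem {n : ℕ} {r : ℝ} (h0 : 0 < r) (h1 : r < 1) (ζ : Torus n) :
    (r : ℂ) • torusPoint ζ ∈ polydisc n := by
  intro j
  simpa [torusPoint, abs_of_pos h0, Circle.norm_coe] using! h1

theorem MemHardy.add {n : ℕ} {f g : (Fin n → ℂ) → ℂ} (hf : MemHardy f) (hg : MemHardy g) :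
    MemHardy (fun z => f z + g z) := by
  obtain ⟨hd, M, hM, h⟩ := hf
  obtain ⟨hd', M', hM', h'⟩ := hg
  refine ⟨hd.add hd', 2 * (M + M'),
    ENNReal.mul_lt_top (by simp) (ENNReal.add_lt_top.2 ⟨hM, hM'⟩), fun r h0 h1 => ?_⟩
  have hc : Continuous fun ζ : Torus n => f ((r : ℂ) • torusPoint ζ) :=
    hd.continuousOn.comp_continuous (continuous_torusPoint.const_smul (r : ℂ))
      (smul_torusPoint_mem h0 h1)
  calc ∫⁻ ζ, ‖f ((r : ℂ) • torusPoint ζ) + g ((r : ℂ) • torusPoint ζ)‖ₑ ^ 2 ∂(torusMeasure n)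
      ≤ ∫⁻ ζ, 2 * (‖f ((r : ℂ) • torusPoint ζ)‖ₑ ^ 2 + ‖g ((r : ℂ) • torusPoint ζ)‖ₑ ^ 2)
          ∂(torusMeasure n) := by
        refine lintegral_mono fun ζ => ?_
        refine (pow_le_pow_left' (enorm_add_le _ _) 2).trans ?_
        have := add_pow_le (R := NNReal) (zero_le (a := ‖f ((r : ℂ) • torusPoint ζ)‖₊))
          (zero_le (a := ‖g ((r : ℂ) • torusPoint ζ)‖₊)) 2
        simp only [enorm_eq_nnnorm]
        norm_num at this
        exact_mod_cast this
    _ = 2 * (∫⁻ ζ, ‖f ((r : ℂ) • torusPoint ζ)‖ₑ ^ 2 ∂(torusMeasure n)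
          + ∫⁻ ζ, ‖g ((r : ℂ) • torusPoint ζ)‖ₑ ^ 2 ∂(torusMeasure n)) := by
        rw [lintegral_const_mul' _ _ (by simp), lintegral_add_left]
        exact (hc.measurable.enorm).pow_const 2
    _ ≤ 2 * (M + M') := by gcongr <;> [exact h r h0 h1; exact h' r h0 h1]

/-- The functions in `L²(𝕋ⁿ)` that are boundary values of `φ g` for some `g ∈ H²(𝔻ⁿ)`. -/
noncomputable def hardyMultiples {n : ℕ} (φ : (Fin n → ℂ) → ℂ) :
    Submodule ℂ (Lp ℂ 2 (torusMeasure n)) where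
  carrier := {F | ∃ g, MemHardy g ∧ HasBoundaryValues (fun z => φ z * g z) F}
  zero_mem' := by
    refine ⟨_, MemHardy.zero, ?_⟩
    filter_upwards [Lp.coeFn_zero ℂ 2 (torusMeasure n)] with ζ hζ
    rw [show (0 : Lp ℂ 2 (torusMeasure n)) ζ = 0 from hζ]
    simp
  add_mem' := by
    rintro F G ⟨f, hf, hF⟩ ⟨g, hg, hG⟩
    refine ⟨_, hf.add hg, ?_⟩
    filter_upwards [hF, hG, Lp.coeFn_add F G] with ζ h1 h2 h3
    rw [h3]
    simpa only [mul_add] using! h1.add h2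
  smul_mem' := by
    rintro c F ⟨f, hf, hF⟩
    refine ⟨_, hf.smul c, ?_⟩
    filter_upwards [hF, Lp.coeFn_smul c F] with ζ h1 h3
    rw [h3]
    simpa only [mul_left_comm, Pi.smul_apply, smul_eq_mul] using! h1.const_mul c

/-- The Hardy space `H²`, as the subspace of `L²(𝕋ⁿ)` formed by the radial boundary values of the
functions in `H²(𝔻ⁿ)`. -/
noncomputable def hardySpace (n : ℕ) : Submodule ℂ (Lp ℂ 2 (torusMeasure n)) :=
  hardyMultiples fun _ => 1

/-- The model space `H² ⊖ I H²`. -/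
noncomputable def modelSpace {n : ℕ} (I : (Fin n → ℂ) → ℂ) :
    Submodule ℂ (Lp ℂ 2 (torusMeasure n)) :=
  hardySpace n ⊓ (hardyMultiples I)ᗮ

/-- The reproducing kernel `K(z, w) = (1 - I(z) conj (I(w))) C(z, w)` of the model space. -/
noncomputable def modelKernel {n : ℕ} (I : (Fin n → ℂ) → ℂ) (w z : Fin n → ℂ) : ℂ :=
  (1 - I z * conj (I w)) * cauchyKernel z w

/-- `σ` is the Clark measure of `φ` at `α`: a finite positive Borel measure on the torus whose
Poisson integral is `Re ((α + φ) / (α - φ))`. -/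
def IsClarkMeasure {n : ℕ} (φ : (Fin n → ℂ) → ℂ) (α : Circle) (σ : Measure (Torus n)) : Prop :=
  IsFiniteMeasure σ ∧ ∀ z ∈ polydisc n,
    ∫ ζ, polydiscPoissonKernel z (torusPoint ζ) ∂σ = ((((α : ℂ) + φ z) / ((α : ℂ) - φ z)).re : ℂ)

open scoped Classical in
/-- The Clark measure `σ_α[φ]`. It exists and is unique for every holomorphic `φ : 𝔻ⁿ → 𝔻` and
every `α ∈ 𝕋`; the value `0` is never used then. -/
noncomputable def clarkMeasure {n : ℕ} (φ : (Fin n → ℂ) → ℂ) (α : Circle) : Measure (Torus n) :=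
  if h : ∃ σ, IsClarkMeasure φ α σ then h.choose else 0

/-- `T` is an isometric linear operator from the model space into `L²(σ_α)` that takes each
reproducing kernel `K_w`, `w ∈ 𝔻ⁿ`, to `(1 - α conj (I(w))) C(·, w)`. -/
def IsClarkOperator {n : ℕ} (I : (Fin n → ℂ) → ℂ) (α : Circle)
    (T : modelSpace I →L[ℂ] Lp ℂ 2 (clarkMeasure I α)) : Prop :=
  (∀ F, ‖T F‖ = ‖F‖) ∧
    ∀ w ∈ polydisc n, ∃ K : modelSpace I,
      HasBoundaryValues (modelKernel I w) (K : Lp ℂ 2 (torusMeasure n)) ∧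
      ∀ᵐ ξ ∂(clarkMeasure I α),
        T K ξ = (1 - (α : ℂ) * conj (I w)) * cauchyKernel (torusPoint ξ) w

open scoped Classical in
/-- The operator `T_α`. For an inner function `I` it is the unique operator with the property
`IsClarkOperator`; the value `0` is never used then. -/
noncomputable def clarkOperator {n : ℕ} (I : (Fin n → ℂ) → ℂ) (α : Circle) :
    modelSpace I →L[ℂ] Lp ℂ 2 (clarkMeasure I α) :=
  if h : ∃ T, IsClarkOperator I α T then h.choose else 0

/-- The polydisc algebra `A(𝔻ⁿ)`: functions continuous on the closed polydisc and holomorphic in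
the open one. -/
def MemPolydiscAlgebra {n : ℕ} (f : (Fin n → ℂ) → ℂ) : Prop :=
  ContinuousOn f (closedPolydisc n) ∧ DifferentiableOn ℂ f (polydisc n)

/-- The elements of `L²(σ)` given by restrictions to the torus of functions in `A(𝔻ⁿ)`. -/
def polydiscAlgebraL2 {n : ℕ} (σ : Measure (Torus n)) : Set (Lp ℂ 2 σ) :=
  {F | ∃ f, MemPolydiscAlgebra f ∧ ∀ᵐ ξ ∂σ, F ξ = f (torusPoint ξ)}

end PolydiscClark

open PolydiscClark

/-! The equivalences rest on one pairing: in L²(σ_α) the inner product of C(·, w) with f is the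
Cauchy transform (f σ_α)₊(w) (`inner_eq_cauchyTransform`). Thus (ii) says that only f = 0 is
orthogonal to all the kernels C(·, w), that is, these kernels span a dense subspace.

(i) ⇔ (ii): the isometry T_α has closed range because the model space is complete, and the range
contains a nonzero multiple of every C(·, w). Conversely, if T_α is unitary and (f σ_α)₊ = 0, then
the preimage of f is orthogonal to every reproducing kernel, hence zero.

(iii) ⇔ (ii): the kernels C(·, w) belong to the polydisc algebra. In the other direction, the Cauchy
formula writes ξ ↦ g(r²ξ) as an average of kernels, so a vanishing Cauchy transform makes f
orthogonal to it; then r → 1.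

Most of the work goes into the objects themselves. `clarkMeasure` and `clarkOperator` are choices
with default value 0, so existence has to be proved. The measure is a weak limit of the densities of
the dilated real part (`exists_measure_poisson`). The operator exists because the images prescribed
for the K_w have the same Gram matrix as the K_w (`integral_cauchyKernel_mul_clark`): on the
diagonal this is the definition of σ_α, and polarization gives the rest. Completeness of the model
space requires that H², described by radial limits, be closed in L² (`isClosed_hardySpace`). Radial
limits of an L² limit come from Fatou's theorem in one variable, applied on almost every slice of
the torus by a diagonal circle (`hasBoundaryValues_of_tendsto_lintegral`). -/

namespace PolydiscClark

/-! ### Translation averages on the torus; the polydisc -/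

section Torus

variable {n : ℕ}

instance isProbabilityMeasure_torusMeasure : IsProbabilityMeasure (torusMeasure n) := by
  unfold torusMeasure; infer_instance

instance isAddLeftInvariant_torusMeasure : (torusMeasure n).IsAddLeftInvariant := by
  unfold torusMeasure; infer_instance

instance isAddRightInvariant_torusMeasure : (torusMeasure n).IsAddRightInvariant := by
  infer_instance

/-- The measure preserving map `(ζ, t) ↦ ζ + ψ t` averaging over translations. -/
theorem measurePreserving_add_comp {T : Type*} [MeasurableSpace T] (τ : Measure T)
    [IsProbabilityMeasure τ] {ψ : T → Torus n} (hψ : Measurable ψ) :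
    MeasurePreserving (fun p : Torus n × T => p.1 + ψ p.2)
      ((torusMeasure n).prod τ) (torusMeasure n) := by
  -- For fixed t the map ζ ↦ ζ + ψ t preserves Haar measure, so the shear preserves the product
  -- measure; projecting to the torus then gives the claim.
  have h1 : MeasurePreserving (fun p : T × Torus n => (p.1, p.2 + ψ p.1))
      (τ.prod (torusMeasure n)) (τ.prod (torusMeasure n)) := by
    refine (MeasurePreserving.id _).skew_product (g := fun t ζ => ζ + ψ t) ?_ ?_
    · exact measurable_snd.add (hψ.comp measurable_fst)
    · exact Eventually.of_forall fun t => map_add_right_eq_self _ _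
  exact (measurePreserving_snd.comp h1).comp Measure.measurePreserving_swap

theorem integral_add_comp {ψ : UnitAddCircle → Torus n} (hψ : Measurable ψ) {F : Torus n → ℂ}
    (hF : Integrable F (torusMeasure n)) :
    ∫ ζ, ∫ t, F (ζ + ψ t) ∂AddCircle.haarAddCircle ∂(torusMeasure n) = ∫ ζ, F ζ ∂(torusMeasure n) := by
  have h := measurePreserving_add_comp AddCircle.haarAddCircle hψ
  have h1 : ∫ ζ, F ζ ∂(torusMeasure n) = ∫ p : Torus n × UnitAddCircle, F (p.1 + ψ p.2)
      ∂((torusMeasure n).prod AddCircle.haarAddCircle) := by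
    rw [← integral_map (φ := fun p : Torus n × UnitAddCircle => p.1 + ψ p.2)
      h.measurable.aemeasurable (by rw [h.map_eq]; exact hF.1), h.map_eq]
  rw [h1]
  exact (integral_prod (fun p : Torus n × UnitAddCircle => F (p.1 + ψ p.2))
    (h.integrable_comp_of_integrable hF)).symm

theorem lintegral_add_comp {T : Type*} [MeasurableSpace T] (τ : Measure T)
    [IsProbabilityMeasure τ] {ψ : T → Torus n} (hψ : Measurable ψ) {F : Torus n → ℝ≥0∞}
    (hF : Measurable F) :
    ∫⁻ ζ, ∫⁻ t, F (ζ + ψ t) ∂τ ∂(torusMeasure n)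
      = ∫⁻ ζ, F ζ ∂(torusMeasure n) := by
  have h := measurePreserving_add_comp τ hψ
  rw [← h.lintegral_comp hF]
  exact (lintegral_prod (fun p : Torus n × T => F (p.1 + ψ p.2))
    (hF.comp h.measurable).aemeasurable).symm

/-- By averaging, the measure of the complement of s is the mean over ζ of its measure along the
curve ζ + ψ. This reduces almost everywhere statements on the torus to statements along slices. -/
theorem ae_of_ae_ae_add_comp {T : Type*} [MeasurableSpace T] (τ : Measure T)
    [IsProbabilityMeasure τ] {ψ : T → Torus n} (hψ : Measurable ψ) {s : Set (Torus n)}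
    (hs : MeasurableSet s)
    (h : ∀ᵐ ζ ∂(torusMeasure n), ∀ᵐ t ∂τ, ζ + ψ t ∈ s) :
    ∀ᵐ ζ ∂(torusMeasure n), ζ ∈ s := by
  have h0 := lintegral_add_comp τ hψ (measurable_const.indicator hs.compl (f := fun _ => (1 : ℝ≥0∞)))
  rw [lintegral_indicator hs.compl, lintegral_congr_ae (g := fun _ => 0)] at h0
  · simpa [ae_iff, Set.compl_def] using h0.symm
  · filter_upwards [h] with ζ hζ
    rw [lintegral_congr_ae (g := fun _ => 0), lintegral_zero]
    filter_upwards [hζ] with t ht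
    simp [ht]

/-- The point `exp (2πit)` of the unit circle, as a complex number. -/
noncomputable def circlePoint (t : UnitAddCircle) : ℂ := (AddCircle.toCircle t : ℂ)

@[simp]
theorem norm_circlePoint (t : UnitAddCircle) : ‖circlePoint t‖ = 1 := Circle.norm_coe _

theorem circlePoint_ne_zero (t : UnitAddCircle) : circlePoint t ≠ 0 := by
  rw [← norm_ne_zero_iff]; simp

theorem circlePoint_mul_conj (t : UnitAddCircle) : circlePoint t * conj (circlePoint t) = 1 := by
  simp [Complex.mul_conj, Complex.normSq_eq_norm_sq]

theorem circlePoint_add (s t : UnitAddCircle) :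
    circlePoint (s + t) = circlePoint s * circlePoint t :=
  congrArg Circle.coeHom (AddCircle.toCircle_add s t)

theorem circlePoint_coe (t : ℝ) : circlePoint (t : UnitAddCircle) = circleMap 0 1 (2 * Real.pi * t) := by
  have : AddCircle.toCircle (t : UnitAddCircle) = Circle.exp (2 * Real.pi / 1 * t) :=
    AddCircle.toCircle_apply_mk t
  rw [circlePoint, this]
  refine (Circle.coe_exp _).trans ?_
  simp [circleMap]

theorem torusPoint_apply (ζ : Torus n) (j : Fin n) : torusPoint ζ j = circlePoint (ζ j) := rfl

@[simp]
theorem norm_torusPoint_apply (ζ : Torus n) (j : Fin n) : ‖torusPoint ζ j‖ = 1 := by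
  simp [torusPoint_apply]

theorem torusPoint_add (ζ η : Torus n) (j : Fin n) :
    torusPoint (ζ + η) j = torusPoint ζ j * torusPoint η j := by
  simp [torusPoint_apply, circlePoint_add]

theorem torusPoint_mem_closedPolydisc (ζ : Torus n) : torusPoint ζ ∈ closedPolydisc n :=
  fun j => by simp

theorem isOpen_polydisc : IsOpen (polydisc n) := by
  simp only [polydisc, Set.ofPred_forall]
  exact isOpen_iInter_of_finite fun j => isOpen_lt (by fun_prop) continuous_const

theorem isClosed_closedPolydisc : IsClosed (closedPolydisc n) := by
  simp only [closedPolydisc, Set.ofPred_forall]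
  exact isClosed_iInter fun j => isClosed_le (by fun_prop) continuous_const

theorem isCompact_closedPolydisc : IsCompact (closedPolydisc n) := by
  refine Metric.isCompact_of_isClosed_isBounded isClosed_closedPolydisc ?_
  refine (Metric.isBounded_closedBall (x := (0 : Fin n → ℂ)) (r := 1)).subset fun z hz => ?_
  rw [mem_closedBall_zero_iff]
  exact (pi_norm_le_iff_of_nonneg zero_le_one).2 hz

theorem polydisc_subset_closedPolydisc : polydisc n ⊆ closedPolydisc n := fun _ hz j => (hz j).le

theorem smul_mem_polydisc {c : ℂ} (hc : ‖c‖ < 1) {z : Fin n → ℂ} (hz : z ∈ closedPolydisc n) :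
    c • z ∈ polydisc n := fun j => by
  rw [Pi.smul_apply, norm_smul]
  exact (mul_le_of_le_one_right (norm_nonneg c) (hz j)).trans_lt hc

theorem real_smul_mem_polydisc {r : ℝ} (hr : r ∈ Set.Ioo (0 : ℝ) 1) {z : Fin n → ℂ}
    (hz : z ∈ closedPolydisc n) : (r : ℂ) • z ∈ polydisc n :=
  smul_mem_polydisc (by simpa [abs_of_pos hr.1] using hr.2) hz

end Torus

/-! ### Cauchy's formula on the circle -/

section Circle

theorem circleAverage_eq_integral_addCircle {E : Type*} [NormedAddCommGroup E] [NormedSpace ℝ E]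
    (f : ℂ → E) :
    Real.circleAverage f 0 1 = ∫ t : UnitAddCircle, f (circlePoint t)
      ∂AddCircle.haarAddCircle := by
  rw [AddCircle.integral_haarAddCircle, ← AddCircle.intervalIntegral_preimage 1 0,
    Real.circleAverage_def]
  have := intervalIntegral.integral_comp_mul_left
    (fun θ => f (circleMap 0 1 θ)) (c := 2 * Real.pi) (a := 0) (b := 1) (by positivity)
  simp only [mul_zero, mul_one] at this
  rw [← this, zero_add, inv_one, one_smul]
  refine intervalIntegral.integral_congr fun t _ => ?_
  simp [circlePoint_coe]

/-- The Cauchy formula for the unit disc. -/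
theorem integral_cauchy_addCircle {φ : ℂ → ℂ} (hφ : DiffContOnCl ℂ φ (Metric.ball 0 1)) {z : ℂ}
    (hz : ‖z‖ < 1) :
    ∫ t : UnitAddCircle, 1 / (1 - z * conj (circlePoint t)) * φ (circlePoint t)
      ∂AddCircle.haarAddCircle = φ z := by
  have h := DiffContOnCl.circleAverage_smul_div (c := 0) (R := 1) (w := z) (by simpa using hφ)
    (by simpa using hz)
  rw [circleAverage_eq_integral_addCircle] at h
  rw [← h]
  refine integral_congr_ae (Eventually.of_forall fun t => ?_)
  have hu := circlePoint_mul_conj t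
  have h0 := circlePoint_ne_zero t
  have h1 : (circlePoint t) - z ≠ 0 := by
    intro h
    have : ‖(circlePoint t)‖ = ‖z‖ := by rw [sub_eq_zero.1 h]
    simp at this
    linarith
  simp only [sub_zero, smul_eq_mul]
  congr 1
  rw [eq_inv_of_mul_eq_one_right hu]
  field_simp

end Circle

/-! ### Cauchy and Poisson formulas on the polydisc -/

section Cauchy

variable {n : ℕ}

theorem one_sub_mul_conj_ne_zero {a b : ℂ} (ha : ‖a‖ < 1) (hb : ‖b‖ ≤ 1) : 1 - a * conj b ≠ 0 := by
  intro h
  have : ‖a * conj b‖ = 1 := by rw [← sub_eq_zero.1 h]; simp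
  rw [norm_mul, Complex.norm_conj] at this
  nlinarith [norm_nonneg a, norm_nonneg b]

theorem conj_cauchyKernel (z w : Fin n → ℂ) : conj (cauchyKernel z w) = cauchyKernel w z := by
  simp [cauchyKernel, mul_comm]

theorem cauchyKernel_ne_zero {z w : Fin n → ℂ} (hz : z ∈ polydisc n) (hw : w ∈ closedPolydisc n) :
    cauchyKernel z w ≠ 0 :=
  Finset.prod_ne_zero_iff.2 fun j _ => one_div_ne_zero (one_sub_mul_conj_ne_zero (hz j) (hw j))

theorem differentiableAt_cauchyKernel {z w : Fin n → ℂ} (hz : z ∈ closedPolydisc n)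
    (hw : w ∈ polydisc n) : DifferentiableAt ℂ (fun z => cauchyKernel z w) z := by
  unfold cauchyKernel
  classical
  have h : ∀ j ∈ Finset.univ,
      DifferentiableAt ℂ (fun x : Fin n → ℂ => 1 / (1 - x j * conj (w j))) z := by
    intro j _
    simp only [one_div]
    refine DifferentiableAt.fun_inv (h := fun x : Fin n → ℂ => 1 - x j * conj (w j))
      (by fun_prop) ?_
    have := one_sub_mul_conj_ne_zero (hw j) (hz j)
    rw [← map_ne_zero (starRingEnd ℂ)] at this
    simpa [mul_comm] using this
  exact (HasFDerivAt.finsetProd fun j hj => (h j hj).hasFDerivAt).differentiableAt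

theorem continuous_cauchyKernel_torusPoint {z : Fin n → ℂ} (hz : z ∈ polydisc n) :
    Continuous fun ζ : Torus n => cauchyKernel z (torusPoint ζ) := by
  unfold cauchyKernel
  refine continuous_finsetProd _ fun j _ => ?_
  refine continuous_const.div ?_ fun ζ =>
    one_sub_mul_conj_ne_zero (hz j) (norm_torusPoint_apply ζ j).le
  have := (continuous_apply j).comp (continuous_torusPoint (n := n))
  exact continuous_const.sub (continuous_const.mul (Complex.continuous_conj.comp this))

theorem continuous_cauchyKernel_torusPoint' {z : Fin n → ℂ} (hz : z ∈ polydisc n) :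
    Continuous fun ζ : Torus n => cauchyKernel (torusPoint ζ) z := by
  simp_rw [← conj_cauchyKernel z]
  exact Complex.continuous_conj.comp (continuous_cauchyKernel_torusPoint hz)

/-- Induction on the set s of coordinates already moved to the torus, the others staying at z. Each
new coordinate costs one application of the Cauchy formula in the disc. -/
theorem integral_cauchy_piecewise {g : (Fin n → ℂ) → ℂ}
    (hg : ∀ z ∈ closedPolydisc n, DifferentiableAt ℂ g z) {z : Fin n → ℂ} (hz : z ∈ polydisc n)
    (s : Finset (Fin n)) :
    ∫ ζ, (∏ j ∈ s, 1 / (1 - z j * conj (torusPoint ζ j))) * g (s.piecewise (torusPoint ζ) z)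
      ∂(torusMeasure n) = g z := by
  have hmem : ∀ (s : Finset (Fin n)) (ζ : Torus n),
      s.piecewise (torusPoint ζ) z ∈ closedPolydisc n := by
    intro s ζ j
    by_cases hj : j ∈ s
    · simp [hj]
    · simpa [hj] using (hz j).le
  have hcg : ContinuousOn g (closedPolydisc n) := fun z hz =>
    (hg z hz).continuousAt.continuousWithinAt
  have hcoord : ∀ j, Continuous fun ζ : Torus n => torusPoint ζ j := fun j =>
    (continuous_apply j).comp continuous_torusPoint
  have hcont : ∀ s : Finset (Fin n), Continuous fun ζ : Torus n =>
      (∏ j ∈ s, 1 / (1 - z j * conj (torusPoint ζ j))) * g (s.piecewise (torusPoint ζ) z) := by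
    intro s
    refine Continuous.mul (continuous_finsetProd _ fun j _ => ?_) ?_
    · exact continuous_const.div
        (continuous_const.sub (continuous_const.mul (Complex.continuous_conj.comp (hcoord j))))
        fun ζ => one_sub_mul_conj_ne_zero (hz j) (norm_torusPoint_apply ζ j).le
    · refine hcg.comp_continuous (continuous_pi fun j => ?_) (hmem s)
      by_cases hj : j ∈ s
      · simpa [hj] using hcoord j
      · simpa [hj] using continuous_const
  induction s using Finset.induction_on with
  | empty => simp
  | insert a s ha ih =>
    have hψ : Measurable fun t : UnitAddCircle => (Pi.single a t : Torus n) :=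
      (continuous_single a).measurable
    -- Averaging over translations of the coordinate a alone isolates a one-variable integral,
    -- without splitting the product measure.
    rw [← integral_add_comp hψ ((hcont _).integrable_of_hasCompactSupport
      (HasCompactSupport.of_compactSpace _)), ← ih]
    refine integral_congr_ae (Eventually.of_forall fun ζ => ?_)
    set p := s.piecewise (torusPoint ζ) z with hp
    have hpa : p a = z a := by simp [hp, ha]
    set φ : ℂ → ℂ := fun c => g (Function.update p a c) with hφ
    have hup : ∀ c, ‖c‖ ≤ 1 → Function.update p a c ∈ closedPolydisc n := by
      intro c hc j
      by_cases hj : j = a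
      · subst hj; simpa using hc
      · simpa [hj] using hmem s ζ j
    have hφd : DiffContOnCl ℂ φ (Metric.ball 0 1) := by
      refine DifferentiableOn.diffContOnCl_ball (U := Metric.closedBall 0 1) ?_ subset_rfl
      intro c hc
      refine DifferentiableAt.differentiableWithinAt ?_
      refine DifferentiableAt.comp (g := g) c (hg _ (hup c (by simpa using hc))) ?_
      exact (hasFDerivAt_update p c).differentiableAt
    have key := integral_cauchy_addCircle hφd (hz a)
    rw [← integral_add_left_eq_self _ (ζ a)] at key
    simp only [hφ] at key
    rw [show Function.update p a (z a) = p by rw [← hpa, Function.update_eq_self]] at key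
    simp only
    rw [← key, ← integral_const_mul]
    refine integral_congr_ae (Eventually.of_forall fun t => ?_)
    simp only
    rw [Finset.prod_insert ha]
    have e1 : torusPoint (ζ + Pi.single a t) a = (circlePoint (ζ a + t)) := by
      simp [torusPoint_apply]
    have e2 : ∀ j ≠ a, torusPoint (ζ + Pi.single a t) j = torusPoint ζ j := by
      intro j hj
      simp [torusPoint_apply, hj]
    have e3 : (insert a s).piecewise (torusPoint (ζ + Pi.single a t)) z
        = Function.update p a (circlePoint (ζ a + t)) := by
      ext j
      by_cases hj : j = a
      · subst hj; simp [e1]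
      · by_cases hjs : j ∈ s <;> simp [hj, hjs, hp, e2 j hj]
    rw [e3, e1, Finset.prod_congr rfl fun j hj => by rw [e2 j (by rintro rfl; exact ha hj)]]
    ring

/-- The Cauchy formula for the polydisc. -/
theorem integral_cauchyKernel_mul {g : (Fin n → ℂ) → ℂ}
    (hg : ∀ z ∈ closedPolydisc n, DifferentiableAt ℂ g z) {z : Fin n → ℂ} (hz : z ∈ polydisc n) :
    ∫ ζ, cauchyKernel z (torusPoint ζ) * g (torusPoint ζ) ∂(torusMeasure n) = g z := by
  simpa [cauchyKernel] using integral_cauchy_piecewise hg hz Finset.univ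

/-- The Poisson formula for holomorphic functions on the polydisc. -/
theorem integral_poissonKernel_mul {g : (Fin n → ℂ) → ℂ}
    (hg : ∀ z ∈ closedPolydisc n, DifferentiableAt ℂ g z) {z : Fin n → ℂ} (hz : z ∈ polydisc n) :
    ∫ ζ, polydiscPoissonKernel z (torusPoint ζ) * g (torusPoint ζ) ∂(torusMeasure n) = g z := by
  -- The Poisson formula for g is the Cauchy formula at z for g · C(·, z) / C(z, z), whose value at
  -- z is g(z).
  have h := integral_cauchyKernel_mul
    (g := fun x => cauchyKernel x z * g x / cauchyKernel z z)
    (fun x hx => by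
      simpa only [div_eq_mul_inv] using
        ((differentiableAt_cauchyKernel hx hz).fun_mul (hg x hx)).mul_const
          (cauchyKernel z z)⁻¹) hz
  rw [mul_div_cancel_left₀ _ (cauchyKernel_ne_zero hz (polydisc_subset_closedPolydisc hz))] at h
  rw [← h]
  refine integral_congr_ae (Eventually.of_forall fun ζ => ?_)
  simp only [polydiscPoissonKernel]
  ring

theorem DifferentiableOn.comp_real_smul {g : (Fin n → ℂ) → ℂ} (hg : DifferentiableOn ℂ g (polydisc n))
    {r : ℝ} (hr : r ∈ Set.Ioo (0 : ℝ) 1) :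
    ∀ z ∈ closedPolydisc n, DifferentiableAt ℂ (fun z => g ((r : ℂ) • z)) z := fun z hz =>
  (hg.differentiableAt (isOpen_polydisc.mem_nhds (real_smul_mem_polydisc hr hz))).comp z
    (by fun_prop)

/-- The real Poisson kernel. -/
noncomputable def realPoissonKernel (z : Fin n → ℂ) (ζ : Torus n) : ℝ :=
  ‖cauchyKernel z (torusPoint ζ)‖ ^ 2 / (∏ j, 1 / (1 - ‖z j‖ ^ 2))

theorem ofReal_realPoissonKernel (z : Fin n → ℂ) (ζ : Torus n) :
    (realPoissonKernel z ζ : ℂ) = polydiscPoissonKernel z (torusPoint ζ) := by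
  rw [realPoissonKernel, polydiscPoissonKernel, ← conj_cauchyKernel z (torusPoint ζ),
    Complex.mul_conj, Complex.normSq_eq_norm_sq]
  simp [cauchyKernel, Complex.mul_conj, Complex.normSq_eq_norm_sq]

theorem realPoissonKernel_nonneg {z : Fin n → ℂ} (hz : z ∈ polydisc n) (ζ : Torus n) :
    0 ≤ realPoissonKernel z ζ := by
  refine div_nonneg (by positivity) (Finset.prod_nonneg fun j _ => ?_)
  have := hz j
  exact one_div_nonneg.2 (by nlinarith [norm_nonneg (z j)])

theorem continuous_realPoissonKernel {z : Fin n → ℂ} (hz : z ∈ polydisc n) :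
    Continuous (realPoissonKernel z) :=
  ((continuous_cauchyKernel_torusPoint hz).norm.pow 2).div_const _

theorem integral_realPoissonKernel {z : Fin n → ℂ} (hz : z ∈ polydisc n) :
    ∫ ζ, realPoissonKernel z ζ ∂(torusMeasure n) = 1 := by
  have := integral_poissonKernel_mul (g := fun _ => 1) (by fun_prop) hz
  simp_rw [← ofReal_realPoissonKernel, mul_one] at this
  exact Complex.ofReal_injective
    ((integral_ofReal (𝕜 := ℂ) (f := realPoissonKernel z)).symm.trans (by simpa using this))

/-- After an exchange of integrals this lets the mass of the kernel be computed in the other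
variable, which yields the L² contraction. -/
theorem realPoissonKernel_symm (r : ℝ) (ζ η : Torus n) :
    realPoissonKernel ((r : ℂ) • torusPoint ζ) η = realPoissonKernel ((r : ℂ) • torusPoint η) ζ := by
  unfold realPoissonKernel
  have h : cauchyKernel ((r : ℂ) • torusPoint ζ) (torusPoint η)
      = conj (cauchyKernel ((r : ℂ) • torusPoint η) (torusPoint ζ)) := by
    rw [conj_cauchyKernel]
    simp [cauchyKernel]
    refine Finset.prod_congr rfl fun j _ => ?_
    ring_nf
  rw [h, Complex.norm_conj]
  simp

end Cauchy

/-! ### Existence of the Clark measure -/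

section ClarkMeasure

variable {n : ℕ}

theorem sub_ne_zero_of_norm_lt (α : Circle) {c : ℂ} (hc : ‖c‖ < 1) : (α : ℂ) - c ≠ 0 := by
  intro h
  rw [← sub_eq_zero.1 h, Circle.norm_coe] at hc
  exact lt_irrefl _ hc

theorem herglotz_re_aux {a c : ℂ} (ha : ‖a‖ = 1) (h0 : a - c ≠ 0) :
    ((a + c) / (a - c)).re = (1 - ‖c‖ ^ 2) / ‖a - c‖ ^ 2 := by
  have h1 : (a + c) / (a - c) = ((a + c) * conj (a - c)) / ((‖a - c‖ ^ 2 : ℝ) : ℂ) := by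
    rw [← Complex.normSq_eq_norm_sq, ← Complex.mul_conj, mul_div_mul_right _ _ ((map_ne_zero _).2 h0)]
  have h2 : a.re ^ 2 + a.im ^ 2 = 1 := by
    have := Complex.normSq_eq_norm_sq a
    rw [ha, Complex.normSq_apply] at this
    linarith
  have h3 : ‖c‖ ^ 2 = c.re ^ 2 + c.im ^ 2 := by
    rw [← Complex.normSq_eq_norm_sq, Complex.normSq_apply]; ring
  rw [h1, Complex.div_ofReal_re, h3, ← h2]
  congr 1
  simp only [map_sub, Complex.mul_re, Complex.add_re, Complex.add_im, Complex.sub_re,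
    Complex.sub_im, Complex.conj_re, Complex.conj_im]
  ring

theorem herglotz_re (α : Circle) {c : ℂ} (hc : ‖c‖ < 1) :
    (((α : ℂ) + c) / ((α : ℂ) - c)).re = (1 - ‖c‖ ^ 2) / ‖(α : ℂ) - c‖ ^ 2 :=
  herglotz_re_aux (Circle.norm_coe α) (sub_ne_zero_of_norm_lt α hc)

theorem herglotz_re_pos (α : Circle) {c : ℂ} (hc : ‖c‖ < 1) :
    0 < (((α : ℂ) + c) / ((α : ℂ) - c)).re := by
  rw [herglotz_re α hc]
  have h0 := norm_pos_iff.2 (sub_ne_zero_of_norm_lt α hc)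
  have : ‖c‖ ^ 2 < 1 := by nlinarith [norm_nonneg c]
  exact div_pos (by linarith) (by positivity)

theorem eventually_Ioo : ∀ᶠ r : ℝ in 𝓝[<] 1, r ∈ Set.Ioo (0 : ℝ) 1 :=
  Ioo_mem_nhdsLT zero_lt_one

theorem tendsto_comp_real_smul {g : (Fin n → ℂ) → ℂ} (hg : DifferentiableOn ℂ g (polydisc n))
    {z : Fin n → ℂ} (hz : z ∈ polydisc n) :
    Tendsto (fun r : ℝ => g ((r : ℂ) • z)) (𝓝[<] 1) (𝓝 (g z)) := by
  have h1 : Tendsto (fun r : ℝ => (r : ℂ) • z) (𝓝[<] 1) (𝓝 z) := by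
    have : Continuous fun r : ℝ => (r : ℂ) • z := by fun_prop
    simpa using (this.tendsto 1).mono_left nhdsWithin_le_nhds
  exact (hg.continuousOn.continuousAt (isOpen_polydisc.mem_nhds hz)).tendsto.comp h1

theorem continuous_comp_real_smul_torusPoint {g : (Fin n → ℂ) → ℂ}
    (hg : DifferentiableOn ℂ g (polydisc n)) {r : ℝ} (hr : r ∈ Set.Ioo (0 : ℝ) 1) :
    Continuous fun ζ : Torus n => g ((r : ℂ) • torusPoint ζ) :=
  hg.continuousOn.comp_continuous (continuous_torusPoint.const_smul (r : ℂ))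
    (smul_torusPoint_mem hr.1 hr.2)

/-- A holomorphic function with positive real part is the Poisson integral of a finite measure. -/
theorem exists_measure_poisson {v : (Fin n → ℂ) → ℂ} (hv : DifferentiableOn ℂ v (polydisc n))
    (hpos : ∀ z ∈ polydisc n, 0 ≤ (v z).re) :
    ∃ σ : Measure (Torus n), IsFiniteMeasure σ ∧ ∀ z ∈ polydisc n,
      ∫ ζ, polydiscPoissonKernel z (torusPoint ζ) ∂σ = ((v z).re : ℂ) := by
  have hcont : ∀ r ∈ Set.Ioo (0 : ℝ) 1,
      Continuous fun ζ : Torus n => (v ((r : ℂ) • torusPoint ζ)).re := fun r hr =>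
    Complex.continuous_re.comp (continuous_comp_real_smul_torusPoint hv hr)
  have hnn : ∀ r ∈ Set.Ioo (0 : ℝ) 1, ∀ ζ : Torus n, 0 ≤ (v ((r : ℂ) • torusPoint ζ)).re :=
    fun r hr ζ => hpos _ (smul_torusPoint_mem hr.1 hr.2 ζ)
  have hP : ∀ r ∈ Set.Ioo (0 : ℝ) 1, ∀ z ∈ polydisc n,
      ∫ ζ, realPoissonKernel z ζ * (v ((r : ℂ) • torusPoint ζ)).re ∂(torusMeasure n)
        = (v ((r : ℂ) • z)).re := by
    intro r hr z hz
    have h := integral_poissonKernel_mul (DifferentiableOn.comp_real_smul hv hr) hz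
    rw [← h, ← RCLike.re_eq_complex_re, ← integral_re]
    · refine integral_congr_ae (Eventually.of_forall fun ζ => ?_)
      simp only [← ofReal_realPoissonKernel]
      simp
    · refine Continuous.integrable_of_hasCompactSupport ?_ (HasCompactSupport.of_compactSpace _)
      simp only [← ofReal_realPoissonKernel]
      exact (Complex.continuous_ofReal.comp (continuous_realPoissonKernel hz)).mul
        (continuous_comp_real_smul_torusPoint hv hr)
  set κ : ℝ → Measure (Torus n) := fun r =>
    (torusMeasure n).withDensity fun ζ => ENNReal.ofReal (v ((r : ℂ) • torusPoint ζ)).re with hκ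
  have hint : ∀ r ∈ Set.Ioo (0 : ℝ) 1, ∀ φ : Torus n → ℝ,
      ∫ ζ, φ ζ ∂(κ r) = ∫ ζ, φ ζ * (v ((r : ℂ) • torusPoint ζ)).re ∂(torusMeasure n) := by
    intro r hr φ
    rw [hκ]
    simp only
    rw [integral_withDensity_eq_integral_toReal_smul₀]
    · refine integral_congr_ae (Eventually.of_forall fun ζ => ?_)
      simp only [smul_eq_mul]
      rw [ENNReal.toReal_ofReal (hnn r hr ζ), mul_comm]
    · exact (hcont r hr).measurable.ennreal_ofReal.aemeasurable
    · simp
  have h0 : (0 : Fin n → ℂ) ∈ polydisc n := fun j => by simp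
  -- P(0, ·) = 1, so the Poisson formula at 0 shows that all the dilated densities have the same
  -- mass Re v(0). This provides the compactness.
  have hmass : ∀ r ∈ Set.Ioo (0 : ℝ) 1, κ r Set.univ = ENNReal.ofReal (v 0).re := by
    intro r hr
    have h1 := hP r hr 0 h0
    have h2 : ∀ ζ : Torus n, realPoissonKernel 0 ζ = 1 := fun ζ => by
      simp [realPoissonKernel, cauchyKernel]
    simp only [h2, one_mul, smul_zero] at h1
    rw [hκ]
    simp only
    rw [withDensity_apply _ MeasurableSet.univ, Measure.restrict_univ,
      ← ofReal_integral_eq_lintegral_ofReal, h1]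
    · exact (hcont r hr).integrable_of_hasCompactSupport (HasCompactSupport.of_compactSpace _)
    · exact Eventually.of_forall (hnn r hr)
  have hfin : ∀ r ∈ Set.Ioo (0 : ℝ) 1, IsFiniteMeasure (κ r) := fun r hr =>
    ⟨by rw [hmass r hr]; exact ENNReal.ofReal_lt_top⟩
  classical
  -- The value 0 outside (0, 1) is immaterial, as only r → 1- matters.
  set m : ℝ → FiniteMeasure (Torus n) := fun r =>
    if hr : r ∈ Set.Ioo (0 : ℝ) 1 then ⟨κ r, hfin r hr⟩ else 0 with hm
  have hmr : ∀ r ∈ Set.Ioo (0 : ℝ) 1, (m r : Measure (Torus n)) = κ r := by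
    intro r hr
    have : m r = ⟨κ r, hfin r hr⟩ := dif_pos hr
    rw [this]
    rfl
  have hK : IsCompact {μ : FiniteMeasure (Torus n) | μ.mass ≤ (v 0).re.toNNReal} :=
    isCompact_setOfPred_finiteMeasure_le_of_compactSpace _ _
  have : (𝓝[<] (1 : ℝ)).NeBot := inferInstance
  -- Along an ultrafilter finer than r → 1-, compactness gives a weak limit at once, with no
  -- extraction of subsequences.
  set 𝒰 : Ultrafilter ℝ := Ultrafilter.of (𝓝[<] (1 : ℝ)) with h𝒰
  have hle : (𝒰 : Filter ℝ) ≤ 𝓝[<] (1 : ℝ) := Ultrafilter.of_le _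
  obtain ⟨σ, -, hσ⟩ := hK.ultrafilter_le_nhds (𝒰.map m) (by
    rw [le_principal_iff]
    refine mem_map.2 (hle ?_)
    filter_upwards [eventually_Ioo] with r hr
    rw [Set.mem_preimage, Set.mem_ofPred_eq]
    have h1 := hmass r hr
    rw [← hmr r hr] at h1
    rw [← ENNReal.coe_le_coe, FiniteMeasure.ennreal_mass, h1, ENNReal.ofReal])
  have hσ' : Tendsto m 𝒰 (𝓝 σ) := hσ
  rw [FiniteMeasure.tendsto_iff_forall_integral_tendsto] at hσ'
  refine ⟨σ, inferInstance, fun z hz => ?_⟩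
  have h1 := hσ' (BoundedContinuousFunction.mkOfCompact ⟨_, continuous_realPoissonKernel hz⟩)
  have h2 : Tendsto (fun r : ℝ => (v ((r : ℂ) • z)).re) 𝒰 (𝓝 (v z).re) :=
    ((Complex.continuous_re.tendsto _).comp (tendsto_comp_real_smul hv hz)).mono_left hle
  have h3 := tendsto_nhds_unique (h1.congr' (hle ?_)) h2
  · simp only [← ofReal_realPoissonKernel]
    rw [← h3]
    exact integral_ofReal (𝕜 := ℂ) (f := realPoissonKernel z)
  · filter_upwards [eventually_Ioo] with r hr
    rw [hmr r hr, hint r hr]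
    exact hP r hr z hz

/-- (α + I)/(α - I) is holomorphic with positive real part. Uniqueness of the measure is never
needed: later arguments use only the defining identity. -/
theorem isClarkMeasure_clarkMeasure {I : (Fin n → ℂ) → ℂ} (hI : IsInner I) (α : Circle) :
    IsClarkMeasure I α (clarkMeasure I α) := by
  have h : ∃ σ, IsClarkMeasure I α σ := by
    refine exists_measure_poisson (v := fun z => ((α : ℂ) + I z) / ((α : ℂ) - I z)) ?_ fun z hz =>
      (herglotz_re_pos α (hI.norm_lt_one z hz)).le
    simp only [div_eq_mul_inv]
    exact (hI.holomorphic.const_add _).mul ((hI.holomorphic.const_sub _).inv fun z hz =>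
      sub_ne_zero_of_norm_lt α (hI.norm_lt_one z hz))
  rw [clarkMeasure, dif_pos h]
  exact h.choose_spec

end ClarkMeasure

/-! ### Holomorphic dependence of integrals on parameters -/

section Holomorphy

variable {n : ℕ} {X : Type*} [TopologicalSpace X] [CompactSpace X]

/-- The function `∏ⱼ (1 - zⱼ χⱼ)⁻¹`, in the algebra of continuous functions. -/
noncomputable def prodInverse (χ : Fin n → C(X, ℂ)) (z : Fin n → ℂ) : C(X, ℂ) :=
  ∏ j, Ring.inverse (1 - z j • χ j)

theorem isUnit_one_sub_smul {φ : C(X, ℂ)} (hφ : ∀ x, ‖φ x‖ ≤ 1) {c : ℂ} (hc : ‖c‖ < 1) :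
    IsUnit (1 - c • φ) := by
  refine isUnit_one_sub_of_norm_lt_one ?_
  rw [norm_smul]
  have : ‖φ‖ ≤ 1 := (ContinuousMap.norm_le _ zero_le_one).2 hφ
  exact (mul_le_of_le_one_right (norm_nonneg c) this).trans_lt hc

theorem prodInverse_apply {χ : Fin n → C(X, ℂ)} (hχ : ∀ j x, ‖χ j x‖ ≤ 1) {z : Fin n → ℂ}
    (hz : z ∈ polydisc n) (x : X) : prodInverse χ z x = ∏ j, 1 / (1 - z j * χ j x) := by
  rw [prodInverse, ContinuousMap.prod_apply]
  refine Finset.prod_congr rfl fun j _ => ?_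
  have h := congrArg (fun φ : C(X, ℂ) => φ x)
    (Ring.inverse_mul_cancel _ (isUnit_one_sub_smul (hχ j) (hz j)))
  simp only [ContinuousMap.mul_apply, ContinuousMap.sub_apply, ContinuousMap.one_apply,
    ContinuousMap.smul_apply, smul_eq_mul] at h
  exact eq_one_div_of_mul_eq_one_left h

/-- Holomorphy holds in the sup norm of the Banach algebra C(X), because inversion is differentiable
at units. Composition with a bounded functional then replaces differentiation under the integral
sign. -/
theorem differentiableAt_prodInverse {χ : Fin n → C(X, ℂ)} (hχ : ∀ j x, ‖χ j x‖ ≤ 1)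
    {z : Fin n → ℂ} (hz : z ∈ polydisc n) : DifferentiableAt ℂ (prodInverse χ) z := by
  classical
  have h : ∀ j ∈ Finset.univ,
      DifferentiableAt ℂ (fun z : Fin n → ℂ => Ring.inverse (1 - z j • χ j)) z := fun j _ =>
    DifferentiableAt.inverse (h := fun z : Fin n → ℂ => 1 - z j • χ j) (by fun_prop)
      (isUnit_one_sub_smul (hχ j) (hz j))
  exact (HasFDerivAt.finsetProd fun j hj => (h j hj).hasFDerivAt).differentiableAt

/-- The functional `φ ↦ ∫ φ f dσ` on the space of continuous functions. -/
noncomputable def integralMulCLM [MeasurableSpace X] [BorelSpace X] {σ : Measure X} {f : X → ℂ}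
    (hf : Integrable f σ) : C(X, ℂ) →L[ℂ] ℂ :=
  LinearMap.mkContinuous
    { toFun := fun φ => ∫ x, φ x * f x ∂σ
      map_add' := fun φ ψ => by
        simp only [ContinuousMap.add_apply, add_mul]
        exact integral_add
          (hf.bdd_mul φ.continuous.aestronglyMeasurable (Eventually.of_forall φ.norm_coe_le_norm))
          (hf.bdd_mul ψ.continuous.aestronglyMeasurable (Eventually.of_forall ψ.norm_coe_le_norm))
      map_smul' := fun c φ => by
        simp only [ContinuousMap.smul_apply, smul_eq_mul, mul_assoc, RingHom.id_apply]
        exact integral_const_mul _ _ }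
    (∫ x, ‖f x‖ ∂σ) fun φ => by
      refine (norm_integral_le_of_norm_le (hf.norm.const_mul ‖φ‖)
        (Eventually.of_forall fun x => ?_)).trans_eq ?_
      · rw [norm_mul]
        gcongr
        exact φ.norm_coe_le_norm x
      · rw [integral_const_mul, mul_comm]

theorem integralMulCLM_apply [MeasurableSpace X] [BorelSpace X] {σ : Measure X} {f : X → ℂ}
    (hf : Integrable f σ) (φ : C(X, ℂ)) : integralMulCLM hf φ = ∫ x, φ x * f x ∂σ := rfl

/-- The coordinates of the torus. -/
noncomputable def torusCoord (j : Fin n) : C(Torus n, ℂ) :=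
  ⟨fun ζ => torusPoint ζ j, (continuous_apply j).comp continuous_torusPoint⟩

theorem prodInverse_star_torusCoord {z : Fin n → ℂ} (hz : z ∈ polydisc n) (ζ : Torus n) :
    prodInverse (fun j => star (torusCoord j)) z ζ = cauchyKernel z (torusPoint ζ) := by
  rw [prodInverse_apply (fun j ζ => by simp [torusCoord]) hz]
  rfl

/-- C(ξ, w) is antiholomorphic in w; conj w serves as the holomorphic parameter. -/
theorem prodInverse_torusCoord {z : Fin n → ℂ} (hz : z ∈ polydisc n) (ζ : Torus n) :
    prodInverse torusCoord z ζ = cauchyKernel (torusPoint ζ) (fun j => conj (z j)) := by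
  rw [prodInverse_apply (fun j ζ => by simp [torusCoord]) hz]
  simp [cauchyKernel, torusCoord, mul_comm]

theorem differentiableOn_cauchyTransform {σ : Measure (Torus n)} {f : Torus n → ℂ}
    (hf : Integrable f σ) : DifferentiableOn ℂ (cauchyTransform σ f) (polydisc n) := by
  have h : DifferentiableOn ℂ
      (fun z => integralMulCLM hf (prodInverse (fun j => star (torusCoord j)) z)) (polydisc n) :=
    fun z hz => ((integralMulCLM hf).differentiableAt.comp z
      (differentiableAt_prodInverse (fun j ζ => by simp [torusCoord]) hz)).differentiableWithinAt
  refine h.congr fun z hz => ?_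
  rw [integralMulCLM_apply, cauchyTransform]
  simp only [prodInverse_star_torusCoord hz]

end Holomorphy

/-! ### Polarization and the Gram matrix of the Clark kernels -/

section Polarization

variable {n : ℕ}

theorem convex_polydisc : Convex ℝ (polydisc n) := by
  have : polydisc n = Set.pi Set.univ fun _ => Metric.ball (0 : ℂ) 1 := by
    ext z; simp [polydisc]
  rw [this]
  exact convex_pi fun j _ => convex_ball _ _

/-- A function holomorphic in the first variable and antiholomorphic in the second one vanishes if
it vanishes on the diagonal. -/
theorem eq_zero_of_diagonal {G : (Fin n → ℂ) → (Fin n → ℂ) → ℂ}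
    (hG : ∀ p q : Fin n → ℂ, DifferentiableOn ℂ (fun c : ℂ => G (p + c • q) (p + conj c • q))
      {c | p + c • q ∈ polydisc n ∧ p + conj c • q ∈ polydisc n})
    (h0 : ∀ z ∈ polydisc n, G z z = 0) {z w : Fin n → ℂ} (hz : z ∈ polydisc n)
    (hw : w ∈ polydisc n) : G z w = 0 := by
  -- The pair (p + c q, p + conj c q) lies on the diagonal for real c and equals (z, w) at c = i.
  -- The function of c is holomorphic on a convex open set and vanishes at real points near 0, so it
  -- vanishes at i.
  set p : Fin n → ℂ := (1 / 2 : ℂ) • (z + w) with hp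
  set q : Fin n → ℂ := (-Complex.I / 2) • (z - w) with hq
  set U : Set ℂ := {c | p + c • q ∈ polydisc n ∧ p + conj c • q ∈ polydisc n} with hU
  have hz' : p + Complex.I • q = z := by
    ext j
    simp only [hp, hq, Pi.add_apply, Pi.smul_apply, Pi.sub_apply, smul_eq_mul]
    linear_combination (-(z j - w j) / 2) * Complex.I_sq
  have hw' : p + conj Complex.I • q = w := by
    ext j
    simp only [hp, hq, Pi.add_apply, Pi.smul_apply, Pi.sub_apply, smul_eq_mul, Complex.conj_I]
    linear_combination ((z j - w j) / 2) * Complex.I_sq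
  have hc1 : Continuous fun c : ℂ => p + c • q := by fun_prop
  have hc2 : Continuous fun c : ℂ => p + conj c • q :=
    continuous_const.add (Complex.continuous_conj.smul continuous_const)
  have hUo : IsOpen U := (isOpen_polydisc.preimage hc1).inter (isOpen_polydisc.preimage hc2)
  have hUc : Convex ℝ U := by
    refine Convex.inter (s := {c : ℂ | p + c • q ∈ polydisc n})
      (t := {c : ℂ | p + conj c • q ∈ polydisc n}) ?_ ?_
    · intro a ha b hb s t hs ht hst
      have := convex_polydisc ha hb hs ht hst
      rw [Set.mem_ofPred_eq]
      convert this using 1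
      ext j
      have h1 : (s : ℂ) + t = 1 := by exact_mod_cast hst
      simp
      linear_combination (-p j) * h1
    · intro a ha b hb s t hs ht hst
      have := convex_polydisc ha hb hs ht hst
      rw [Set.mem_ofPred_eq]
      convert this using 1
      ext j
      have h1 : (s : ℂ) + t = 1 := by exact_mod_cast hst
      simp
      linear_combination (-p j) * h1
  have hpm : p ∈ polydisc n := by
    have := convex_polydisc hz hw (a := 1 / 2) (b := 1 / 2) (by norm_num) (by norm_num)
      (by norm_num)
    convert this using 1
    ext j
    simp [hp]
  have h0U : (0 : ℂ) ∈ U := by simpa [hU] using hpm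
  have hIU : Complex.I ∈ U := ⟨by rw [hz']; exact hz, by rw [hw']; exact hw⟩
  have han : AnalyticOnNhd ℂ (fun c : ℂ => G (p + c • q) (p + conj c • q)) U :=
    (hG p q).analyticOnNhd hUo
  have hfreq : ∃ᶠ c in 𝓝[≠] (0 : ℂ), G (p + c • q) (p + conj c • q) = 0 := by
    have ht : Tendsto (fun t : ℝ => (t : ℂ)) (𝓝[≠] 0) (𝓝[≠] (0 : ℂ)) := by
      refine tendsto_nhdsWithin_iff.2 ⟨?_, ?_⟩
      · simpa using (Complex.continuous_ofReal.tendsto 0).mono_left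
          (nhdsWithin_le_nhds (s := {0}ᶜ))
      · filter_upwards [self_mem_nhdsWithin] with t ht
        simpa using ht
    refine ht.frequently (Eventually.frequently ?_)
    have : ∀ᶠ t : ℝ in 𝓝[≠] 0, (t : ℂ) ∈ U :=
      (ht.mono_right nhdsWithin_le_nhds).eventually (hUo.mem_nhds h0U)
    filter_upwards [this] with t ht
    rw [Complex.conj_ofReal]
    exact h0 _ ht.1
  have := han.eqOn_zero_of_preconnected_of_frequently_eq_zero hUc.isPreconnected h0U hfreq hIU
  simpa only [hz', hw'] using! this

/-- The Clark measure reproduces the kernel of the model space. -/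
theorem integral_cauchyKernel_mul_clark {I : (Fin n → ℂ) → ℂ} (hI : IsInner I) {α : Circle}
    {σ : Measure (Torus n)} (hσ : IsClarkMeasure I α σ) {z w : Fin n → ℂ} (hz : z ∈ polydisc n)
    (hw : w ∈ polydisc n) :
    (1 - (α : ℂ) * conj (I w)) * (1 - conj (α : ℂ) * I z) *
      ∫ ξ, cauchyKernel z (torusPoint ξ) * cauchyKernel (torusPoint ξ) w ∂σ = modelKernel I w z := by
  obtain ⟨hfin, hσ⟩ := hσ
  refine sub_eq_zero.1 (eq_zero_of_diagonal (G := fun z w =>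
    (1 - (α : ℂ) * conj (I w)) * (1 - conj (α : ℂ) * I z) *
      (∫ ξ, cauchyKernel z (torusPoint ξ) * cauchyKernel (torusPoint ξ) w ∂σ) - modelKernel I w z)
    ?_ ?_ hz hw)
  · intro p q c hc
    refine DifferentiableAt.differentiableWithinAt ?_
    have hline : DifferentiableAt ℂ (fun c : ℂ => p + c • q) c := by fun_prop
    set pc : Fin n → ℂ := fun j => conj (p j)
    set qc : Fin n → ℂ := fun j => conj (q j)
    have hline' : DifferentiableAt ℂ (fun c : ℂ => pc + c • qc) c := by fun_prop
    have hmem : ∀ c : ℂ, pc + c • qc = fun j => conj ((p + conj c • q) j) := by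
      intro c; ext j; simp [pc, qc]
    have hc2 : pc + c • qc ∈ polydisc n := fun j => by
      rw [hmem, Complex.norm_conj]; exact hc.2 j
    have hI1 : DifferentiableAt ℂ (fun c : ℂ => I (p + c • q)) c :=
      (hI.holomorphic.differentiableAt (isOpen_polydisc.mem_nhds hc.1)).comp c hline
    have hI2 : DifferentiableAt ℂ (fun c : ℂ => conj (I (p + conj c • q))) c := by
      have : DifferentiableAt ℂ (fun c : ℂ => I (p + c • q)) (conj c) :=
        (hI.holomorphic.differentiableAt (isOpen_polydisc.mem_nhds hc.2)).comp (conj c)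
          (by fun_prop)
      simpa [Function.comp_def] using this.conj_conj
    have hC : DifferentiableAt ℂ (fun c : ℂ => cauchyKernel (p + c • q) (p + conj c • q)) c := by
      have : ∀ c : ℂ, cauchyKernel (p + c • q) (p + conj c • q)
          = ∏ j, (1 - (p j + c * q j) * (pc j + c * qc j))⁻¹ := by
        intro c
        refine Finset.prod_congr rfl fun j _ => ?_
        simp [pc, qc]
      simp only [this]
      refine DifferentiableAt.fun_finsetProd fun j _ => ?_
      refine DifferentiableAt.fun_inv (by fun_prop) ?_
      have := one_sub_mul_conj_ne_zero (hc.1 j) (hc.2 j).le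
      simpa [pc, qc] using this
    have hint : DifferentiableAt ℂ (fun c : ℂ => ∫ ξ, cauchyKernel (p + c • q) (torusPoint ξ) *
        cauchyKernel (torusPoint ξ) (p + conj c • q) ∂σ) c := by
      have h1 : Integrable (fun _ : Torus n => (1 : ℂ)) σ := integrable_const _
      -- The functional is integration against σ with density 1; the two kernels are multiplied
      -- inside the algebra of continuous functions.
      have h2 : DifferentiableAt ℂ (fun c : ℂ => integralMulCLM h1
          (prodInverse (fun j => star (torusCoord j)) (p + c • q) *
            prodInverse torusCoord (pc + c • qc))) c := by
        refine (integralMulCLM h1).differentiableAt.comp c (DifferentiableAt.fun_mul ?_ ?_)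
        · exact DifferentiableAt.comp (g := prodInverse fun j => star (torusCoord j)) c
            (differentiableAt_prodInverse (fun j ζ => by simp [torusCoord]) hc.1) hline
        · exact DifferentiableAt.comp (g := prodInverse torusCoord) c
            (differentiableAt_prodInverse (fun j ζ => by simp [torusCoord]) hc2) hline'
      refine h2.congr_of_eventuallyEq ?_
      have hcont1 : Continuous fun c : ℂ => p + c • q := by fun_prop
      have hcont2 : Continuous fun c : ℂ => pc + c • qc := by fun_prop
      filter_upwards [hcont1.continuousAt.preimage_mem_nhds (isOpen_polydisc.mem_nhds hc.1),
        hcont2.continuousAt.preimage_mem_nhds (isOpen_polydisc.mem_nhds hc2)] with d hd1 hd2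
      rw [integralMulCLM_apply]
      refine integral_congr_ae (Eventually.of_forall fun ξ => ?_)
      simp only [ContinuousMap.mul_apply, mul_one]
      rw [prodInverse_star_torusCoord hd1, prodInverse_torusCoord hd2]
      simp only [hmem, Complex.conj_conj]
    simp only [modelKernel]
    exact (((hI2.const_mul _).const_sub _).fun_mul ((hI1.const_mul _).const_sub _)).fun_mul hint
      |>.fun_sub (((hI1.fun_mul hI2).const_sub _).fun_mul hC)
  · intro z hz
    have h1 := hσ z hz
    simp only [polydiscPoissonKernel] at h1
    rw [integral_div, herglotz_re α (hI.norm_lt_one z hz)] at h1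
    have hne := cauchyKernel_ne_zero hz (polydisc_subset_closedPolydisc hz)
    rw [div_eq_iff hne] at h1
    have h2 := sub_ne_zero_of_norm_lt α (hI.norm_lt_one z hz)
    have hα : (α : ℂ) * conj (α : ℂ) = 1 := by simp [Complex.mul_conj]
    -- On the diagonal the prefactor is |α - I(z)|², the denominator of the Herglotz real part,
    -- leaving (1 - |I(z)|²) C(z, z).
    have h3 : (1 - (α : ℂ) * conj (I z)) * (1 - conj (α : ℂ) * I z)
        = ((‖(α : ℂ) - I z‖ ^ 2 : ℝ) : ℂ) := by
      rw [← Complex.normSq_eq_norm_sq, ← Complex.mul_conj, map_sub]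
      linear_combination (I z * conj (I z) - 1) * hα
    have h4 : ((‖I z‖ ^ 2 : ℝ) : ℂ) = I z * conj (I z) := by
      rw [← Complex.normSq_eq_norm_sq, ← Complex.mul_conj]
    have h5 : ((‖(α : ℂ) - I z‖ ^ 2 : ℝ) : ℂ) ≠ 0 := by
      exact_mod_cast pow_ne_zero 2 (norm_ne_zero_iff.2 h2)
    simp only [modelKernel]
    rw [h1, h3, ← h4, Complex.ofReal_div, ← mul_assoc, mul_div_cancel₀ _ h5]
    push_cast
    ring

end Polarization

/-! ### Fatou's theorem in one variable -/

section Fatou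

/-- The Poisson kernel of the disc at the real point `r`, as a function on the line. -/
noncomputable def linePoissonKernel (r t : ℝ) : ℝ :=
  (1 - r ^ 2) / (1 - 2 * r * Real.cos (2 * Real.pi * t) + r ^ 2)

theorem linePoissonKernel_denom_pos {r : ℝ} (hr : r ∈ Set.Ioo (0 : ℝ) 1) (t : ℝ) :
    0 < 1 - 2 * r * Real.cos (2 * Real.pi * t) + r ^ 2 := by
  have := Real.cos_le_one (2 * Real.pi * t)
  nlinarith [hr.1, hr.2, mul_nonneg hr.1.le (sub_nonneg.2 this), sq_pos_of_pos (sub_pos.2 hr.2)]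

/-- The derivative of `linePoissonKernel`. -/
noncomputable def linePoissonKernelDeriv (r t : ℝ) : ℝ :=
  -((1 - r ^ 2) * (4 * Real.pi * r * Real.sin (2 * Real.pi * t)))
    / (1 - 2 * r * Real.cos (2 * Real.pi * t) + r ^ 2) ^ 2

theorem hasDerivAt_linePoissonKernel {r : ℝ} (hr : r ∈ Set.Ioo (0 : ℝ) 1) (t : ℝ) :
    HasDerivAt (linePoissonKernel r) (linePoissonKernelDeriv r t) t := by
  have h1 : HasDerivAt (fun t => 1 - 2 * r * Real.cos (2 * Real.pi * t) + r ^ 2)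
      (4 * Real.pi * r * Real.sin (2 * Real.pi * t)) t := by
    have h2 : HasDerivAt (fun t : ℝ => 2 * Real.pi * t) (2 * Real.pi) t := by
      simpa using (hasDerivAt_id t).const_mul (2 * Real.pi)
    refine (((h2.cos.const_mul (2 * r)).const_sub 1).add_const (r ^ 2)).congr_deriv ?_
    ring
  have h3 := (hasDerivAt_const t (1 - r ^ 2)).fun_div h1 (linePoissonKernel_denom_pos hr t).ne'
  refine h3.congr_deriv ?_
  rw [linePoissonKernelDeriv, zero_mul, zero_sub]

theorem continuous_linePoissonKernel {r : ℝ} (hr : r ∈ Set.Ioo (0 : ℝ) 1) :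
    Continuous (linePoissonKernel r) :=
  continuous_const.div (by fun_prop) fun t => (linePoissonKernel_denom_pos hr t).ne'

theorem continuous_linePoissonKernelDeriv {r : ℝ} (hr : r ∈ Set.Ioo (0 : ℝ) 1) :
    Continuous (linePoissonKernelDeriv r) :=
  Continuous.div (by fun_prop) (by fun_prop)
    fun t => pow_ne_zero 2 (linePoissonKernel_denom_pos hr t).ne'

theorem absolutelyContinuousOnInterval_linePoissonKernel {r : ℝ} (hr : r ∈ Set.Ioo (0 : ℝ) 1)
    (a b : ℝ) : AbsolutelyContinuousOnInterval (linePoissonKernel r) a b := by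
  refine ContDiffOn.absolutelyContinuousOnInterval (ContDiff.contDiffOn ?_)
  refine contDiff_one_iff_deriv.2
    ⟨fun t => (hasDerivAt_linePoissonKernel hr t).differentiableAt, ?_⟩
  rw [funext fun t => (hasDerivAt_linePoissonKernel hr t).deriv]
  exact continuous_linePoissonKernelDeriv hr

theorem linePoissonKernel_circlePoint (r t : ℝ) :
    linePoissonKernel r t = (1 - r ^ 2) / ‖circlePoint (t : UnitAddCircle) - r‖ ^ 2 := by
  rw [linePoissonKernel, circlePoint_coe, ← Complex.normSq_eq_norm_sq]
  congr 1
  simp only [circleMap, Complex.ofReal_one, one_mul, zero_add]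
  rw [Complex.exp_ofReal_mul_I, Complex.normSq_apply]
  simp [-Complex.ofReal_mul, -Complex.ofReal_cos, -Complex.ofReal_sin]
  nlinarith [Real.sin_sq_add_cos_sq (2 * Real.pi * t)]

/-- The Poisson formula for the disc on the line, at real points. -/
theorem integral_linePoissonKernel_mul {φ : ℂ → ℂ} (hφ : DiffContOnCl ℂ φ (Metric.ball 0 1))
    {r : ℝ} (hr : r ∈ Set.Ioo (0 : ℝ) 1) :
    ∫ t in (-(1 / 2) : ℝ)..1 / 2, (linePoissonKernel r t : ℂ) * φ (circlePoint t) = φ r := by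
  have h := hφ.circleAverage_poissonKernel_smul (w := (r : ℂ))
    (by simpa [abs_of_pos hr.1] using hr.2)
  rw [circleAverage_eq_integral_addCircle, AddCircle.integral_haarAddCircle,
    ← AddCircle.intervalIntegral_preimage 1 (-(1 / 2)), inv_one, one_smul] at h
  rw [← h, show (-(1 / 2) : ℝ) + 1 = 1 / 2 by norm_num]
  refine intervalIntegral.integral_congr fun t _ => ?_
  simp [poissonKernel, linePoissonKernel_circlePoint, abs_of_pos hr.1]

theorem integral_linePoissonKernel {r : ℝ} (hr : r ∈ Set.Ioo (0 : ℝ) 1) :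
    ∫ t in (-(1 / 2) : ℝ)..1 / 2, linePoissonKernel r t = 1 := by
  have h := integral_linePoissonKernel_mul (φ := fun _ => 1) diffContOnCl_const hr
  simp only [mul_one] at h
  rw [intervalIntegral.integral_ofReal] at h
  exact_mod_cast h

theorem linePoissonKernel_half {r : ℝ} (hr : r ∈ Set.Ioo (0 : ℝ) 1) :
    linePoissonKernel r (1 / 2) = (1 - r) / (1 + r) := by
  have : 0 < 1 + r := by linarith [hr.1]
  rw [linePoissonKernel, show 2 * Real.pi * (1 / 2) = Real.pi by ring, Real.cos_pi,
    div_eq_div_iff (by nlinarith) this.ne']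
  ring

theorem linePoissonKernel_neg (r t : ℝ) : linePoissonKernel r (-t) = linePoissonKernel r t := by
  simp [linePoissonKernel]

/-- Integration by parts: the integral equals 1 minus the boundary term (1 - r)/(1 + r), which is
nonnegative. With the sign given by the next lemma, this bounds the L¹ norm of t P_r'(t) uniformly
in r. -/
theorem integral_neg_mul_linePoissonKernelDeriv_le {r : ℝ} (hr : r ∈ Set.Ioo (0 : ℝ) 1) :
    ∫ t in (-(1 / 2) : ℝ)..1 / 2, -(t * linePoissonKernelDeriv r t) ≤ 1 := by
  have h := intervalIntegral.integral_mul_deriv_eq_deriv_mul (a := (-(1 / 2) : ℝ)) (b := 1 / 2)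
    (u := fun t => t) (u' := fun _ => 1) (v := linePoissonKernel r) (v' := linePoissonKernelDeriv r)
    (fun t _ => hasDerivAt_id t) (fun t _ => hasDerivAt_linePoissonKernel hr t)
    (by simp) ((continuous_linePoissonKernelDeriv hr).intervalIntegrable _ _)
  simp only [one_mul, integral_linePoissonKernel hr, linePoissonKernel_neg,
    linePoissonKernel_half hr] at h
  rw [intervalIntegral.integral_neg, h]
  have : 0 ≤ (1 - r) / (1 + r) := div_nonneg (by linarith [hr.2]) (by linarith [hr.1])
  linarith

theorem neg_mul_linePoissonKernelDeriv_nonneg {r : ℝ} (hr : r ∈ Set.Ioo (0 : ℝ) 1) {t : ℝ}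
    (ht : t ∈ Set.Icc (-(1 / 2) : ℝ) (1 / 2)) : 0 ≤ -(t * linePoissonKernelDeriv r t) := by
  have hsin : 0 ≤ t * Real.sin (2 * Real.pi * t) := by
    rcases le_total 0 t with h | h
    · exact mul_nonneg h (Real.sin_nonneg_of_nonneg_of_le_pi (by positivity)
        (by nlinarith [Real.pi_pos, ht.2]))
    · have : 0 ≤ Real.sin (2 * Real.pi * (-t)) :=
        Real.sin_nonneg_of_nonneg_of_le_pi (mul_nonneg (by positivity) (by linarith))
          (by nlinarith [Real.pi_pos, ht.1])
      rw [mul_neg, Real.sin_neg] at this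
      nlinarith
  have h1 : 0 ≤ 1 - r ^ 2 := by nlinarith [hr.1, hr.2]
  have : -(t * linePoissonKernelDeriv r t) = (1 - r ^ 2) * (4 * Real.pi * r *
      (t * Real.sin (2 * Real.pi * t))) / (1 - 2 * r * Real.cos (2 * Real.pi * t) + r ^ 2) ^ 2 := by
    rw [linePoissonKernelDeriv]; ring
  rw [this]
  have := hr.1
  positivity

/-- The denominator of P_r is (1 - r)² + 2r(1 - cos 2πt), hence at least 1 - cos 2πδ when 2r ≥ 1;
this is why r starts at 1/2. -/
theorem abs_linePoissonKernelDeriv_le {r δ : ℝ} (hr : r ∈ Set.Ico (1 / 2 : ℝ) 1) (hδ : 0 < δ)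
    {t : ℝ} (ht : t ∈ Set.Icc (-(1 / 2) : ℝ) (1 / 2)) (hδt : δ ≤ |t|) :
    |linePoissonKernelDeriv r t|
      ≤ (1 - r ^ 2) * (4 * Real.pi / (1 - Real.cos (2 * Real.pi * δ)) ^ 2) := by
  have ht' : |t| ≤ 1 / 2 := abs_le.2 ht
  have hδ' : δ ≤ 1 / 2 := hδt.trans ht'
  have hcos : Real.cos (2 * Real.pi * t) ≤ Real.cos (2 * Real.pi * δ) := by
    rw [← Real.cos_abs (2 * Real.pi * t), abs_mul, abs_of_pos (by positivity : 0 < 2 * Real.pi)]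
    refine Real.cos_le_cos_of_nonneg_of_le_pi (by positivity) (by nlinarith [Real.pi_pos]) ?_
    gcongr
  have hc : 0 < 1 - Real.cos (2 * Real.pi * δ) := by
    have := Real.cos_lt_cos_of_nonneg_of_le_pi le_rfl
      (by nlinarith [Real.pi_pos] : 2 * Real.pi * δ ≤ Real.pi) (by positivity)
    rw [Real.cos_zero] at this
    linarith
  have hD : 1 - Real.cos (2 * Real.pi * δ) ≤ 1 - 2 * r * Real.cos (2 * Real.pi * t) + r ^ 2 := by
    nlinarith [hr.1, hr.2, sq_nonneg (1 - r), Real.cos_le_one (2 * Real.pi * t)]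
  have h1 : 0 ≤ 1 - r ^ 2 := by nlinarith [hr.1, hr.2]
  rw [linePoissonKernelDeriv, abs_div, abs_neg, abs_mul, abs_of_nonneg h1,
    abs_of_nonneg (sq_nonneg (_ : ℝ)), mul_div_assoc]
  gcongr
  rw [abs_mul, abs_mul, abs_of_pos (by positivity : 0 < 4 * Real.pi),
    abs_of_nonneg (by linarith [hr.1] : 0 ≤ r)]
  have h2 := Real.abs_sin_le_one (2 * Real.pi * t)
  have h3 : r * |Real.sin (2 * Real.pi * t)| ≤ 1 := by
    nlinarith [hr.1, hr.2, abs_nonneg (Real.sin (2 * Real.pi * t))]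
  nlinarith [Real.pi_pos]

/-- Integration by parts moves the derivative onto the kernel, leaving P_r' against the primitive
Φ(t) = o(t). Near 0 this is small compared with |t P_r'(t)|, whose integral is at most 1; away from
0 the derivative is O(1 - r²). -/
theorem tendsto_integral_linePoissonKernel_mul_of_hasDerivAt_zero {h : ℝ → ℝ}
    (hh : IntervalIntegrable h volume (-(1 / 2)) (1 / 2))
    (hd : HasDerivAt (fun t => ∫ s in (0 : ℝ)..t, h s) 0 0) :
    Tendsto (fun r => ∫ t in (-(1 / 2) : ℝ)..1 / 2, linePoissonKernel r t * h t) (𝓝[<] 1) (𝓝 0) := by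
  set Φ : ℝ → ℝ := fun t => ∫ s in (0 : ℝ)..t, h s with hΦ
  have h0 : (0 : ℝ) ∈ Set.uIcc (-(1 / 2) : ℝ) (1 / 2) := by
    rw [Set.uIcc_of_le (by norm_num)]; constructor <;> norm_num
  have hΦac : AbsolutelyContinuousOnInterval Φ (-(1 / 2)) (1 / 2) :=
    hh.absolutelyContinuousOnInterval_intervalIntegral h0
  have hΦc : ContinuousOn Φ (Set.Icc (-(1 / 2)) (1 / 2)) := by
    have := hΦac.continuousOn
    rwa [Set.uIcc_of_le (by norm_num)] at this
  obtain ⟨M, hM⟩ := isCompact_Icc.exists_bound_of_continuousOn hΦc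
  have hM0 : 0 ≤ M := (norm_nonneg _).trans (hM 0 (by constructor <;> norm_num))
  have hparts : ∀ r ∈ Set.Ioo (0 : ℝ) 1,
      ∫ t in (-(1 / 2) : ℝ)..1 / 2, linePoissonKernel r t * h t
        = (1 - r) / (1 + r) * (Φ (1 / 2) - Φ (-(1 / 2)))
          - ∫ t in (-(1 / 2) : ℝ)..1 / 2, linePoissonKernelDeriv r t * Φ t := by
    intro r hr
    have h1 := (absolutelyContinuousOnInterval_linePoissonKernel hr
      (-(1 / 2)) (1 / 2)).integral_mul_deriv_eq_deriv_mul hΦac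
    rw [linePoissonKernel_neg, linePoissonKernel_half hr] at h1
    rw [mul_sub]
    simp only [(hasDerivAt_linePoissonKernel hr _).deriv] at h1
    rw [← h1]
    refine intervalIntegral.integral_congr_ae ?_
    filter_upwards [hh.ae_hasDerivAt_integral] with t ht htm
    rw [(ht (Set.uIoc_subset_uIcc htm) 0 h0).deriv]
  rw [Metric.tendsto_nhds]
  intro ε hε
  have hlit : ∀ᶠ t in 𝓝 (0 : ℝ), ‖Φ t‖ ≤ ε / 2 * ‖t‖ := by
    have := (hasDerivAt_iff_isLittleO.1 hd).def (half_pos hε)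
    simpa [hΦ] using this
  obtain ⟨δ', hδ', hδ''⟩ := Metric.eventually_nhds_iff.1 hlit
  -- For |t| ≥ δ' and r ≥ 1/2, the product P_r' Φ is at most (1 - r²) C, with C independent of r.
  set C : ℝ := M * (4 * Real.pi / (1 - Real.cos (2 * Real.pi * (δ' / 2))) ^ 2) with hC
  have hC0 : 0 ≤ C := by positivity
  have hlim : Tendsto (fun r : ℝ => (1 - r) * (2 * M) + (ε / 2 + (1 - r ^ 2) * C)) (𝓝[<] 1)
      (𝓝 (ε / 2)) := by
    have : Continuous fun r : ℝ => (1 - r) * (2 * M) + (ε / 2 + (1 - r ^ 2) * C) := by fun_prop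
    simpa using (this.tendsto 1).mono_left nhdsWithin_le_nhds
  have hIco : ∀ᶠ r : ℝ in 𝓝[<] 1, r ∈ Set.Ico (1 / 2 : ℝ) 1 :=
    Ico_mem_nhdsLT (by norm_num)
  filter_upwards [hlim.eventually (gt_mem_nhds (half_lt_self hε)), hIco] with r hrlt hr
  have hr' : r ∈ Set.Ioo (0 : ℝ) 1 := ⟨by linarith [hr.1], hr.2⟩
  rw [dist_zero_right, hparts r hr']
  refine lt_of_le_of_lt ?_ hrlt
  refine (norm_sub_le _ _).trans (add_le_add ?_ ?_)
  · rw [norm_mul]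
    have e1 : ‖(1 - r) / (1 + r)‖ ≤ 1 - r := by
      rw [Real.norm_of_nonneg (div_nonneg (by linarith [hr.2]) (by linarith [hr'.1]))]
      exact div_le_self (by linarith [hr.2]) (by linarith [hr'.1])
    have e2 : ‖Φ (1 / 2) - Φ (-(1 / 2))‖ ≤ 2 * M := by
      refine (norm_sub_le _ _).trans ?_
      have := hM (1 / 2) (by constructor <;> norm_num)
      have := hM (-(1 / 2)) (by constructor <;> norm_num)
      linarith
    exact mul_le_mul e1 e2 (norm_nonneg _) (by linarith [hr.2])
  · have hbound : ∀ t ∈ Set.Icc (-(1 / 2) : ℝ) (1 / 2), ‖linePoissonKernelDeriv r t * Φ t‖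
        ≤ ε / 2 * (-(t * linePoissonKernelDeriv r t)) + (1 - r ^ 2) * C := by
      intro t ht
      have hn := neg_mul_linePoissonKernelDeriv_nonneg hr' ht
      have hr2 : 0 ≤ 1 - r ^ 2 := by nlinarith [hr.1, hr.2]
      rw [norm_mul]
      by_cases htδ : |t| < δ'
      · have h1 := hδ'' (by simpa using htδ)
        have h2 : ‖linePoissonKernelDeriv r t‖ * ‖t‖ = -(t * linePoissonKernelDeriv r t) := by
          rw [← norm_mul, mul_comm, ← norm_neg, Real.norm_of_nonneg hn]
        rw [← h2]
        have := mul_le_mul_of_nonneg_left h1 (norm_nonneg (linePoissonKernelDeriv r t))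
        nlinarith [mul_nonneg hr2 hC0]
      · have h1 := abs_linePoissonKernelDeriv_le (δ := δ' / 2) hr (by positivity) ht
          (by linarith [not_lt.1 htδ])
        have h2 := mul_le_mul h1 (hM t ht) (norm_nonneg _) ((abs_nonneg _).trans h1)
        rw [Real.norm_eq_abs]
        rw [hC]
        nlinarith [mul_nonneg hε.le hn]
    have hint1 : IntervalIntegrable (fun t => ε / 2 * (-(t * linePoissonKernelDeriv r t))) volume
        (-(1 / 2)) (1 / 2) :=
      (continuous_const.mul (continuous_id.mul
        (continuous_linePoissonKernelDeriv hr')).neg).intervalIntegrable _ _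
    refine (intervalIntegral.norm_integral_le_of_norm_le (by norm_num)
      (Eventually.of_forall fun t ht => hbound t (Set.Ioc_subset_Icc_self ht))
      (hint1.add (by simp))).trans ?_
    rw [intervalIntegral.integral_add hint1 (by simp), intervalIntegral.integral_const_mul]
    have := integral_neg_mul_linePoissonKernelDeriv_le hr'
    norm_num
    norm_num at this
    nlinarith

theorem intervalIntegrable_comp_const_add {E : Type*} [NormedAddCommGroup E] {h : ℝ → E}
    (hh : ∀ a b, IntervalIntegrable h volume a b) (x a b : ℝ) :
    IntervalIntegrable (fun t => h (x + t)) volume a b := by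
  have := (hh (x + a) (x + b)).comp_add_left x
  simpa using this

/-- **Fatou's theorem** at a point of differentiability of the primitive, for real functions. -/
theorem tendsto_integral_linePoissonKernel_mul_of_hasDerivAt {h : ℝ → ℝ}
    (hh : ∀ a b, IntervalIntegrable h volume a b) {x : ℝ}
    (hd : HasDerivAt (fun y => ∫ s in (0 : ℝ)..y, h s) (h x) x) :
    Tendsto (fun r => ∫ t in (-(1 / 2) : ℝ)..1 / 2, linePoissonKernel r t * h (x + t)) (𝓝[<] 1)
      (𝓝 (h x)) := by
  have hshift := intervalIntegrable_comp_const_add hh x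
  -- The kernel has integral 1, so subtracting the constant h(x) reduces to a primitive with zero
  -- derivative at the origin.
  have hd0 : HasDerivAt (fun t => ∫ s in (0 : ℝ)..t, (h (x + s) - h x)) 0 0 := by
    have e : ∀ t, ∫ s in (0 : ℝ)..t, (h (x + s) - h x)
        = (∫ s in (0 : ℝ)..(x + t), h s) - (∫ s in (0 : ℝ)..x, h s) - t * h x := by
      intro t
      rw [intervalIntegral.integral_sub (hshift 0 t) (by simp),
        intervalIntegral.integral_comp_add_left, add_zero,
        intervalIntegral.integral_interval_sub_left (hh _ _) (hh _ _)]
      simp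
    simp only [e]
    have h1 : HasDerivAt (fun t => ∫ s in (0 : ℝ)..(x + t), h s) (h x) 0 := by
      have : HasDerivAt (fun y => ∫ s in (0 : ℝ)..y, h s) (h x) (x + 0) := by simpa using hd
      exact this.comp_const_add x 0
    have h2 : HasDerivAt (fun t : ℝ => t * h x) (h x) 0 := by
      simpa using (hasDerivAt_id (0 : ℝ)).mul_const (h x)
    exact ((h1.sub_const _).fun_sub h2).congr_deriv (sub_self _)
  have h1 := tendsto_integral_linePoissonKernel_mul_of_hasDerivAt_zero
    ((hshift _ _).sub (by simp)) hd0
  have h2 := h1.add_const (h x)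
  rw [zero_add] at h2
  refine h2.congr' ?_
  filter_upwards [eventually_Ioo] with r hr
  have hc := continuous_linePoissonKernel hr
  simp only [mul_sub]
  rw [intervalIntegral.integral_sub, intervalIntegral.integral_mul_const,
    integral_linePoissonKernel hr]
  · ring
  · exact (hshift _ _).continuousOn_mul hc.continuousOn
  · exact (hc.mul continuous_const).intervalIntegrable _ _

/-- **Fatou's theorem** for the Poisson integrals of complex functions on the line. -/
theorem ae_tendsto_integral_linePoissonKernel_mul {h : ℝ → ℂ}
    (hh : ∀ a b, IntervalIntegrable h volume a b) :
    ∀ᵐ x, Tendsto (fun r => ∫ t in (-(1 / 2) : ℝ)..1 / 2, (linePoissonKernel r t : ℂ) * h (x + t))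
      (𝓝[<] 1) (𝓝 (h x)) := by
  have hre : ∀ a b, IntervalIntegrable (fun x => (h x).re) volume a b := fun a b =>
    ⟨(hh a b).1.re, (hh a b).2.re⟩
  have him : ∀ a b, IntervalIntegrable (fun x => (h x).im) volume a b := fun a b =>
    ⟨(hh a b).1.im, (hh a b).2.im⟩
  have hloc : ∀ {g : ℝ → ℝ}, (∀ a b, IntervalIntegrable g volume a b) →
      LocallyIntegrable g volume := by
    intro g hg x
    refine ⟨Set.Ioc (x - 1) (x + 1), Ioc_mem_nhds (by linarith) (by linarith), ?_⟩
    exact (hg (x - 1) (x + 1)).1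
  filter_upwards [LocallyIntegrable.ae_hasDerivAt_integral (hloc hre),
    LocallyIntegrable.ae_hasDerivAt_integral (hloc him)] with x h1 h2
  have t1 := tendsto_integral_linePoissonKernel_mul_of_hasDerivAt hre (h1 0)
  have t2 := tendsto_integral_linePoissonKernel_mul_of_hasDerivAt him (h2 0)
  have t3 := ((Complex.continuous_ofReal.tendsto _).comp t1).add
    (((Complex.continuous_ofReal.tendsto _).comp t2).mul_const Complex.I)
  rw [Complex.re_add_im] at t3
  refine t3.congr' ?_
  filter_upwards [eventually_Ioo] with r hr
  have hc := continuous_linePoissonKernel hr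
  simp only [Function.comp_apply]
  rw [← intervalIntegral.integral_ofReal, ← intervalIntegral.integral_ofReal,
    ← intervalIntegral.integral_mul_const, ← intervalIntegral.integral_add]
  · refine intervalIntegral.integral_congr fun t _ => ?_
    conv_rhs => rw [← Complex.re_add_im (h (x + t))]
    push_cast
    ring
  · have := ((intervalIntegrable_comp_const_add hre x (-(1 / 2)) (1 / 2)).continuousOn_mul
      hc.continuousOn)
    exact ⟨this.1.ofReal, this.2.ofReal⟩
  · have := ((intervalIntegrable_comp_const_add him x (-(1 / 2)) (1 / 2)).continuousOn_mul
      hc.continuousOn)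
    exact IntervalIntegrable.mul_const ⟨this.1.ofReal, this.2.ofReal⟩ _

end Fatou

/-! ### L¹ convergence from L² bounds -/

section Convergence

/-- Where D exceeds N, D ≤ D²/N. The truncated part is open to dominated convergence and the rest is
controlled by the L² bound. -/
theorem lintegral_le_lintegral_min_add {X : Type*} [MeasurableSpace X] {ν : Measure X}
    {D : X → ℝ≥0∞} (hD : Measurable D) {N : ℝ≥0∞} (hN : N ≠ 0) (hN' : N ≠ ∞) :
    ∫⁻ x, D x ∂ν ≤ ∫⁻ x, min (D x) N ∂ν + (∫⁻ x, D x ^ 2 ∂ν) / N := by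
  have h : ∀ x, D x ≤ min (D x) N + D x ^ 2 * N⁻¹ := by
    intro x
    rcases le_total (D x) N with hx | hx
    · rw [min_eq_left hx]; exact le_self_add
    · refine le_add_left ?_
      calc D x = D x * (N * N⁻¹) := by rw [ENNReal.mul_inv_cancel hN hN', mul_one]
        _ ≤ D x * (D x * N⁻¹) := by gcongr
        _ = D x ^ 2 * N⁻¹ := by ring
  calc ∫⁻ x, D x ∂ν ≤ ∫⁻ x, (min (D x) N + D x ^ 2 * N⁻¹) ∂ν := lintegral_mono h
    _ = _ := by
      rw [lintegral_add_left (hD.min measurable_const), lintegral_mul_const' _ _ (by simpa using hN),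
        div_eq_mul_inv]

/-- Boundedness in `L²` and convergence almost everywhere imply convergence in `L¹`. -/
theorem tendsto_lintegral_zero_of_sq_bounded {X ι : Type*} [MeasurableSpace X] {ν : Measure X}
    [IsFiniteMeasure ν] {l : Filter ι} [l.IsCountablyGenerated] {D : ι → X → ℝ≥0∞} {M : ℝ≥0∞}
    (hM : M < ∞) (hD : ∀ᶠ i in l, Measurable (D i)) (hb : ∀ᶠ i in l, ∫⁻ x, D i x ^ 2 ∂ν ≤ M)
    (h0 : ∀ᵐ x ∂ν, Tendsto (fun i => D i x) l (𝓝 0)) :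
    Tendsto (fun i => ∫⁻ x, D i x ∂ν) l (𝓝 0) := by
  rw [ENNReal.tendsto_nhds_zero]
  intro ε hε
  obtain ⟨N, hN⟩ : ∃ N : ℕ, M / N < ε / 2 ∧ N ≠ 0 := by
    have : Tendsto (fun N : ℕ => M / N) atTop (𝓝 0) := by
      simpa using ENNReal.Tendsto.const_div ENNReal.tendsto_nat_nhds_top (Or.inr hM.ne)
    exact ((this.eventually (gt_mem_nhds (ENNReal.half_pos hε.ne'))).and
      (eventually_ne_atTop 0)).exists
  have hmin : Tendsto (fun i => ∫⁻ x, min (D i x) N ∂ν) l (𝓝 (∫⁻ _, 0 ∂ν)) := by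
    refine tendsto_lintegral_filter_of_dominated_convergence (fun _ => (N : ℝ≥0∞))
      (hD.mono fun i hi => hi.min measurable_const)
      (Eventually.of_forall fun i => Eventually.of_forall fun x => min_le_right _ _) ?_ ?_
    · rw [lintegral_const]
      exact ENNReal.mul_ne_top (by simp) (measure_ne_top _ _)
    · filter_upwards [h0] with x hx
      simpa using hx.min (tendsto_const_nhds (x := (N : ℝ≥0∞)))
  rw [lintegral_zero] at hmin
  filter_upwards [hD, hb, hmin.eventually (gt_mem_nhds (ENNReal.half_pos hε.ne'))] with i h1 h2 h3
  calc ∫⁻ x, D i x ∂ν ≤ ∫⁻ x, min (D i x) N ∂ν + (∫⁻ x, D i x ^ 2 ∂ν) / N :=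
        lintegral_le_lintegral_min_add h1 (by simpa using hN.2) (by simp)
    _ ≤ ε / 2 + ε / 2 := add_le_add h3.le ((ENNReal.div_le_div_right h2 _).trans hN.1.le)
    _ = ε := ENNReal.add_halves ε

theorem sq_enorm_sub_le (a b : ℂ) : ‖a - b‖ₑ ^ 2 ≤ 2 * (‖a‖ₑ ^ 2 + ‖b‖ₑ ^ 2) := by
  refine (pow_le_pow_left' (enorm_sub_le (a := a) (b := b)) 2).trans ?_
  have := add_pow_le (R := NNReal) (zero_le (a := ‖a‖₊)) (zero_le (a := ‖b‖₊)) 2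
  simp only [enorm_eq_nnnorm]
  norm_num at this
  exact_mod_cast this

theorem eLpNorm_two_sq {X : Type*} [MeasurableSpace X] (ν : Measure X) (f : X → ℂ) :
    eLpNorm f 2 ν ^ 2 = ∫⁻ x, ‖f x‖ₑ ^ 2 ∂ν := by
  have := eLpNorm_nnreal_pow_eq_lintegral (μ := ν) (f := f) (p := 2) two_ne_zero
  simpa using this

theorem lintegral_sq_enorm_lt_top {X : Type*} [MeasurableSpace X] {ν : Measure X} (F : Lp ℂ 2 ν) :
    ∫⁻ x, ‖F x‖ₑ ^ 2 ∂ν < ∞ := by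
  rw [← eLpNorm_two_sq]
  exact ENNReal.pow_lt_top (Lp.eLpNorm_lt_top F)

theorem lintegral_enorm_le_sqrt {X : Type*} [MeasurableSpace X] {ν : Measure X}
    [IsProbabilityMeasure ν] {f : X → ℂ} (hf : AEStronglyMeasurable f ν) :
    (∫⁻ x, ‖f x‖ₑ ∂ν) ^ 2 ≤ ∫⁻ x, ‖f x‖ₑ ^ 2 ∂ν := by
  rw [← eLpNorm_two_sq, ← eLpNorm_one_eq_lintegral_enorm]
  gcongr
  exact eLpNorm_le_eLpNorm_of_exponent_le (by norm_num) hf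

theorem integrable_Lp_two {X : Type*} [MeasurableSpace X] {ν : Measure X} [IsFiniteMeasure ν]
    (F : Lp ℂ 2 ν) : Integrable F ν := (Lp.memLp F).integrable (by norm_num)

theorem continuous_integral_mul {n : ℕ} {σ : Measure (Torus n)} [IsFiniteMeasure σ]
    {k : Torus n → ℂ} (hk : Continuous k) :
    Continuous fun F : Lp ℂ 2 σ => ∫ ζ, k ζ * F ζ ∂σ := by
  -- The conjugate turns integration against k into an inner product, so continuity is that of the
  -- inner product.
  set K : C(Torus n, ℂ) := ⟨fun ζ => conj (k ζ), Complex.continuous_conj.comp hk⟩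
  have : (fun F : Lp ℂ 2 σ => ∫ ζ, k ζ * F ζ ∂σ)
      = fun F => ⟪ContinuousMap.toLp 2 σ ℂ K, F⟫_ℂ := by
    ext F
    rw [L2.inner_def]
    refine integral_congr_ae ?_
    filter_upwards [ContinuousMap.coeFn_toLp (p := 2) (𝕜 := ℂ) σ K] with ζ hζ
    rw [hζ]
    simp [K, mul_comm]
  rw [this]
  exact continuous_const.inner continuous_id

end Convergence

/-! ### Boundary values of H² functions and integral formulas -/

section Hardy

variable {n : ℕ}

theorem mem_hardySpace_iff {F : Lp ℂ 2 (torusMeasure n)} :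
    F ∈ hardySpace n ↔ ∃ f, MemHardy f ∧ HasBoundaryValues f F := by
  change (∃ g, MemHardy g ∧ HasBoundaryValues (fun z => 1 * g z) F) ↔ _
  simp only [one_mul]

/-- The L² bound on dilations and almost everywhere convergence suffice for L¹ convergence; no
maximal function is involved. L¹ is enough to pass to the limit against continuous kernels. -/
theorem MemHardy.tendsto_lintegral_sub {f : (Fin n → ℂ) → ℂ} (hf : MemHardy f)
    {F : Lp ℂ 2 (torusMeasure n)} (hF : HasBoundaryValues f F) :
    Tendsto (fun r : ℝ => ∫⁻ ζ, ‖f ((r : ℂ) • torusPoint ζ) - F ζ‖ₑ ∂(torusMeasure n)) (𝓝[<] 1)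
      (𝓝 0) := by
  obtain ⟨hd, M, hM, hb⟩ := hf
  have hFm : Measurable F := (Lp.stronglyMeasurable F).measurable
  refine tendsto_lintegral_zero_of_sq_bounded
    (M := 2 * (M + ∫⁻ ζ, ‖F ζ‖ₑ ^ 2 ∂(torusMeasure n))) ?_ ?_ ?_ ?_
  · exact ENNReal.mul_lt_top (by simp) (ENNReal.add_lt_top.2 ⟨hM, lintegral_sq_enorm_lt_top F⟩)
  · filter_upwards [eventually_Ioo] with r hr
    exact ((continuous_comp_real_smul_torusPoint hd hr).measurable.sub hFm).enorm
  · filter_upwards [eventually_Ioo] with r hr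
    refine (lintegral_mono fun ζ => sq_enorm_sub_le _ _).trans ?_
    rw [lintegral_const_mul' _ _ (by simp), lintegral_add_right _ (hFm.enorm.pow_const 2)]
    gcongr
    exact hb r hr.1 hr.2
  · filter_upwards [hF] with ζ hζ
    have := (hζ.sub_const (F ζ)).enorm
    simpa using this

theorem MemHardy.tendsto_integral_mul {f : (Fin n → ℂ) → ℂ} (hf : MemHardy f)
    {F : Lp ℂ 2 (torusMeasure n)} (hF : HasBoundaryValues f F) {k : Torus n → ℂ}
    (hk : Continuous k) :
    Tendsto (fun r : ℝ => ∫ ζ, k ζ * f ((r : ℂ) • torusPoint ζ) ∂(torusMeasure n)) (𝓝[<] 1)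
      (𝓝 (∫ ζ, k ζ * F ζ ∂(torusMeasure n))) := by
  obtain ⟨C, hC⟩ : ∃ C : NNReal, ∀ ζ, ‖k ζ‖₊ ≤ C := by
    obtain ⟨C, hC⟩ := isCompact_univ.exists_bound_of_continuousOn hk.continuousOn
    exact ⟨C.toNNReal, fun ζ => by
      rw [← NNReal.coe_le_coe, coe_nnnorm]
      exact (hC ζ trivial).trans (Real.le_coe_toNNReal C)⟩
  have hkF : Integrable (fun ζ => k ζ * F ζ) (torusMeasure n) :=
    (integrable_Lp_two F).bdd_mul (c := C) hk.aestronglyMeasurable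
      (Eventually.of_forall fun ζ => by exact_mod_cast hC ζ)
  refine tendsto_integral_of_L1 _ hkF.1 ?_ ?_
  · filter_upwards [eventually_Ioo] with r hr
    exact (hk.mul (continuous_comp_real_smul_torusPoint hf.1 hr)).integrable_of_hasCompactSupport
      (HasCompactSupport.of_compactSpace _)
  · have h1 := ENNReal.Tendsto.const_mul (a := (C : ℝ≥0∞)) (hf.tendsto_lintegral_sub hF)
      (Or.inr (by simp))
    rw [mul_zero] at h1
    refine tendsto_of_tendsto_of_tendsto_of_le_of_le tendsto_const_nhds h1 (fun _ => zero_le) ?_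
    intro r
    simp only
    rw [← lintegral_const_mul' _ _ (by simp)]
    refine lintegral_mono fun ζ => ?_
    rw [← mul_sub, enorm_mul]
    gcongr
    exact ENNReal.coe_le_coe.2 (hC ζ)

theorem MemHardy.integral_mul_eq {f : (Fin n → ℂ) → ℂ} (hf : MemHardy f)
    {F : Lp ℂ 2 (torusMeasure n)} (hF : HasBoundaryValues f F) {k : Torus n → ℂ}
    (hk : Continuous k) {w : Fin n → ℂ} (hw : w ∈ polydisc n)
    (h : ∀ r ∈ Set.Ioo (0 : ℝ) 1,
      ∫ ζ, k ζ * f ((r : ℂ) • torusPoint ζ) ∂(torusMeasure n) = f ((r : ℂ) • w)) :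
    ∫ ζ, k ζ * F ζ ∂(torusMeasure n) = f w := by
  refine tendsto_nhds_unique (hf.tendsto_integral_mul hF hk)
    ((tendsto_comp_real_smul hf.1 hw).congr' ?_)
  filter_upwards [eventually_Ioo] with r hr
  exact (h r hr).symm

/-- Functions in `H²` are the Cauchy integrals of their boundary values. -/
theorem MemHardy.integral_cauchyKernel_mul {f : (Fin n → ℂ) → ℂ} (hf : MemHardy f)
    {F : Lp ℂ 2 (torusMeasure n)} (hF : HasBoundaryValues f F) {w : Fin n → ℂ}
    (hw : w ∈ polydisc n) :
    ∫ ζ, cauchyKernel w (torusPoint ζ) * F ζ ∂(torusMeasure n) = f w :=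
  hf.integral_mul_eq hF (continuous_cauchyKernel_torusPoint hw) hw fun _ hr =>
    PolydiscClark.integral_cauchyKernel_mul (DifferentiableOn.comp_real_smul hf.1 hr) hw

/-- Functions in `H²` are the Poisson integrals of their boundary values. -/
theorem MemHardy.integral_poissonKernel_mul {f : (Fin n → ℂ) → ℂ} (hf : MemHardy f)
    {F : Lp ℂ 2 (torusMeasure n)} (hF : HasBoundaryValues f F) {w : Fin n → ℂ}
    (hw : w ∈ polydisc n) :
    ∫ ζ, (realPoissonKernel w ζ : ℂ) * F ζ ∂(torusMeasure n) = f w := by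
  refine hf.integral_mul_eq hF (Complex.continuous_ofReal.comp (continuous_realPoissonKernel hw)) hw
    fun r hr => ?_
  simp only [Function.comp_apply, ofReal_realPoissonKernel]
  exact PolydiscClark.integral_poissonKernel_mul (DifferentiableOn.comp_real_smul hf.1 hr) hw

theorem continuous_realPoissonKernel_smul {r : ℝ} (hr : r ∈ Set.Ioo (0 : ℝ) 1) :
    Continuous fun p : Torus n × Torus n => realPoissonKernel ((r : ℂ) • torusPoint p.1) p.2 := by
  unfold realPoissonKernel cauchyKernel
  have hc : ∀ j, Continuous fun ζ : Torus n => torusPoint ζ j := fun j =>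
    (continuous_apply j).comp continuous_torusPoint
  have h1 : Continuous fun p : Torus n × Torus n =>
      ∏ j, 1 / (1 - ((r : ℂ) • torusPoint p.1) j * conj (torusPoint p.2 j)) := by
    refine continuous_finsetProd _ fun j _ => continuous_const.div ?_ fun p => ?_
    · exact continuous_const.sub ((((hc j).comp continuous_fst).const_smul (r : ℂ)).mul
        (Complex.continuous_conj.comp ((hc j).comp continuous_snd)))
    · exact one_sub_mul_conj_ne_zero (smul_torusPoint_mem hr.1 hr.2 _ j)
        (norm_torusPoint_apply _ _).le
  simp only [Pi.smul_apply, norm_smul, norm_torusPoint_apply] at h1 ⊢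
  exact (h1.norm.pow 2).div_const _

theorem lintegral_realPoissonKernel {z : Fin n → ℂ} (hz : z ∈ polydisc n) :
    ∫⁻ ζ, ENNReal.ofReal (realPoissonKernel z ζ) ∂(torusMeasure n) = 1 := by
  rw [← ofReal_integral_eq_lintegral_ofReal, integral_realPoissonKernel hz, ENNReal.ofReal_one]
  · exact (continuous_realPoissonKernel hz).integrable_of_hasCompactSupport
      (HasCompactSupport.of_compactSpace _)
  · exact Eventually.of_forall (realPoissonKernel_nonneg hz)

/-- The kernel is a probability density, and for a probability measure the L¹ norm is at most the L²
norm. -/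
theorem sq_enorm_integral_realPoissonKernel_mul_le {z : Fin n → ℂ} (hz : z ∈ polydisc n)
    {F : Torus n → ℂ} (hF : Measurable F) :
    ‖∫ ζ, (realPoissonKernel z ζ : ℂ) * F ζ ∂(torusMeasure n)‖ₑ ^ 2
      ≤ ∫⁻ ζ, ENNReal.ofReal (realPoissonKernel z ζ) * ‖F ζ‖ₑ ^ 2 ∂(torusMeasure n) := by
  set κ := (torusMeasure n).withDensity fun ζ => ENNReal.ofReal (realPoissonKernel z ζ) with hκ
  have hm : Measurable fun ζ : Torus n => ENNReal.ofReal (realPoissonKernel z ζ) :=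
    (continuous_realPoissonKernel hz).measurable.ennreal_ofReal
  have : IsProbabilityMeasure κ := ⟨by
    rw [hκ, withDensity_apply _ MeasurableSet.univ, Measure.restrict_univ,
      lintegral_realPoissonKernel hz]⟩
  have h1 := lintegral_enorm_le_sqrt (ν := κ) (f := F) hF.aestronglyMeasurable
  rw [hκ, lintegral_withDensity_eq_lintegral_mul _ hm hF.enorm,
    lintegral_withDensity_eq_lintegral_mul _ hm (hF.enorm.pow_const 2)] at h1
  refine le_trans ?_ h1
  gcongr
  refine (enorm_integral_le_lintegral_enorm _).trans (lintegral_mono fun ζ => ?_)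
  rw [enorm_mul, Pi.mul_apply]
  gcongr
  rw [← ofReal_norm, Complex.norm_real, Real.norm_of_nonneg (realPoissonKernel_nonneg hz ζ)]

/-- Poisson integrals are contractive in `L²`. -/
theorem lintegral_sq_enorm_integral_realPoissonKernel_mul_le {r : ℝ} (hr : r ∈ Set.Ioo (0 : ℝ) 1)
    {F : Torus n → ℂ} (hF : Measurable F) :
    ∫⁻ ζ, ‖∫ ξ, (realPoissonKernel ((r : ℂ) • torusPoint ζ) ξ : ℂ) * F ξ ∂(torusMeasure n)‖ₑ ^ 2
      ∂(torusMeasure n) ≤ ∫⁻ ζ, ‖F ζ‖ₑ ^ 2 ∂(torusMeasure n) := by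
  have hP := (continuous_realPoissonKernel_smul (n := n) hr).measurable.ennreal_ofReal
  calc _ ≤ ∫⁻ ζ, ∫⁻ ξ, ENNReal.ofReal (realPoissonKernel ((r : ℂ) • torusPoint ζ) ξ) * ‖F ξ‖ₑ ^ 2
        ∂(torusMeasure n) ∂(torusMeasure n) := lintegral_mono fun ζ =>
          sq_enorm_integral_realPoissonKernel_mul_le (smul_torusPoint_mem hr.1 hr.2 ζ) hF
    _ = ∫⁻ ξ, ∫⁻ ζ, ENNReal.ofReal (realPoissonKernel ((r : ℂ) • torusPoint ζ) ξ) * ‖F ξ‖ₑ ^ 2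
        ∂(torusMeasure n) ∂(torusMeasure n) :=
          lintegral_lintegral_swap
            (hP.mul ((hF.comp measurable_snd).enorm.pow_const 2)).aemeasurable
    _ = _ := by
      refine lintegral_congr fun ξ => ?_
      simp only [realPoissonKernel_symm r _ ξ]
      rw [lintegral_mul_const _ ?_,
        lintegral_realPoissonKernel (smul_torusPoint_mem hr.1 hr.2 ξ), one_mul]
      exact (continuous_realPoissonKernel (smul_torusPoint_mem hr.1 hr.2 ξ)).measurable.ennreal_ofReal

end Hardy

/-! ### Radial limits by slicing -/

section Radial

variable {n : ℕ}

/-- Each dilation is continuous, so closeness for all r in an interval ending at 1 is an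
intersection of closed conditions on (ζ, F ζ). The uncountable intersection over r is therefore
harmless; only the tolerance and the interval need countable indices. -/
theorem measurableSet_tendsto_radial {f : (Fin n → ℂ) → ℂ} (hf : DifferentiableOn ℂ f (polydisc n))
    {F : Torus n → ℂ} (hF : Measurable F) :
    MeasurableSet {ζ : Torus n |
      Tendsto (fun r : ℝ => f ((r : ℂ) • torusPoint ζ)) (𝓝[<] 1) (𝓝 (F ζ))} := by
  set A : ℕ → ℕ → Set (Torus n × ℂ) := fun N K =>
    ⋂ r ∈ Set.Ioo (1 - 1 / ((K : ℝ) + 1)) 1,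
      {p | dist (f ((r : ℂ) • torusPoint p.1)) p.2 ≤ 1 / ((N : ℝ) + 1)} with hA
  have hsub : ∀ K : ℕ, ∀ r ∈ Set.Ioo (1 - 1 / ((K : ℝ) + 1)) 1, r ∈ Set.Ioo (0 : ℝ) 1 := by
    intro K r hr
    refine ⟨lt_of_le_of_lt ?_ hr.1, hr.2⟩
    rw [sub_nonneg, div_le_one (by positivity)]
    linarith [(Nat.cast_nonneg K : (0 : ℝ) ≤ K)]
  have hclosed : ∀ N K, IsClosed (A N K) := by
    intro N K
    refine isClosed_biInter fun r hr => isClosed_le ?_ continuous_const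
    exact ((continuous_comp_real_smul_torusPoint hf (hsub K r hr)).comp continuous_fst).dist
      continuous_snd
  have hset : {ζ : Torus n |
      Tendsto (fun r : ℝ => f ((r : ℂ) • torusPoint ζ)) (𝓝[<] 1) (𝓝 (F ζ))}
      = ⋂ N : ℕ, ⋃ K : ℕ, (fun ζ => (ζ, F ζ)) ⁻¹' A N K := by
    ext ζ
    simp only [Set.mem_iInter, Set.mem_iUnion, Set.mem_preimage, hA, Set.mem_ofPred_eq]
    constructor
    · intro h N
      have h1 := (Metric.tendsto_nhds.1 h) (1 / ((N : ℝ) + 1)) (by positivity)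
      obtain ⟨l, hl, hl'⟩ := (mem_nhdsLT_iff_exists_Ioo_subset (a := (1 : ℝ))).1 h1
      obtain ⟨K, hK⟩ := exists_nat_one_div_lt (sub_pos.2 (Set.mem_Iio.1 hl))
      exact ⟨K, fun r hr => (hl' ⟨by linarith [hr.1], hr.2⟩ : _ < _).le⟩
    · intro h
      rw [Metric.tendsto_nhds]
      intro ε hε
      obtain ⟨N, hN⟩ := exists_nat_one_div_lt hε
      obtain ⟨K, hK⟩ := h N
      have : Set.Ioo (1 - 1 / ((K : ℝ) + 1)) 1 ∈ 𝓝[<] (1 : ℝ) :=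
        Ioo_mem_nhdsLT (by linarith [(by positivity : 0 < 1 / ((K : ℝ) + 1))])
      filter_upwards [this] with r hr
      exact lt_of_le_of_lt (hK r hr) hN
  rw [hset]
  exact MeasurableSet.iInter fun N => MeasurableSet.iUnion fun K =>
    (measurable_id.prodMk hF) (hclosed N K).measurableSet

/-- The diagonal embedding of the circle in the torus. -/
def diagonal (n : ℕ) (t : UnitAddCircle) : Torus n := fun _ => t

theorem continuous_diagonal : Continuous (diagonal n) := continuous_pi fun _ => continuous_id

theorem torusPoint_add_diagonal (ζ : Torus n) (t : UnitAddCircle) :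
    torusPoint (ζ + diagonal n t) = circlePoint t • torusPoint ζ := by
  ext j
  rw [torusPoint_add, Pi.smul_apply, smul_eq_mul, mul_comm]
  rfl

theorem diagonal_add (s t : UnitAddCircle) :
    diagonal n (s + t) = diagonal n s + diagonal n t := rfl

/-- Poisson formula on the slices of the torus. -/
theorem integral_linePoissonKernel_mul_slice {f : (Fin n → ℂ) → ℂ}
    (hf : DifferentiableOn ℂ f (polydisc n)) {s r : ℝ} (hs : s ∈ Set.Ioo (0 : ℝ) 1)
    (hr : r ∈ Set.Ioo (0 : ℝ) 1) (ζ : Torus n) :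
    ∫ t in (-(1 / 2) : ℝ)..1 / 2, (linePoissonKernel r t : ℂ) *
      f ((s : ℂ) • torusPoint (ζ + diagonal n t)) = f ((s : ℂ) • ((r : ℂ) • torusPoint ζ)) := by
  have hd : DiffContOnCl ℂ (fun c : ℂ => f ((s : ℂ) • (c • torusPoint ζ))) (Metric.ball 0 1) := by
    refine DifferentiableOn.diffContOnCl_ball (U := Metric.closedBall 0 1) ?_ subset_rfl
    intro c hc
    refine DifferentiableAt.differentiableWithinAt ?_
    have hmem : c • torusPoint ζ ∈ closedPolydisc n := fun j => by
      rw [Pi.smul_apply, norm_smul, norm_torusPoint_apply, mul_one]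
      simpa using hc
    exact DifferentiableAt.comp (g := fun z => f ((s : ℂ) • z)) c
      (DifferentiableOn.comp_real_smul hf hs _ hmem) (by fun_prop)
  rw [← integral_linePoissonKernel_mul hd hr]
  simp only [torusPoint_add_diagonal]

theorem exists_seq_Ioo_tendsto :
    ∃ s : ℕ → ℝ, (∀ k, s k ∈ Set.Ioo (0 : ℝ) 1) ∧ Tendsto s atTop (𝓝[<] 1) := by
  obtain ⟨s, -, hs, hs1⟩ := exists_seq_strictMono_tendsto' (zero_lt_one (α := ℝ))
  exact ⟨s, hs, tendsto_nhdsWithin_iff.2 ⟨hs1, Eventually.of_forall fun k => (hs k).2⟩⟩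

theorem eq_zero_of_tendsto_of_le_mul_of_liminf_eq_zero {L a : ℕ → ℝ≥0∞} {l C : ℝ≥0∞}
    (hL : Tendsto L atTop (𝓝 l)) (hC : C ≠ ∞) (h : ∀ k, L k ≤ C * a k)
    (ha : liminf a atTop = 0) : l = 0 := by
  by_contra hl
  obtain ⟨c, hc0, hcl⟩ := exists_between (pos_iff_ne_zero.2 hl)
  have h1 : c / C ≤ liminf a atTop := by
    refine le_liminf_of_le (by isBoundedDefault) ?_
    filter_upwards [hL.eventually (lt_mem_nhds hcl)] with k hk
    exact ENNReal.div_le_of_le_mul' (hk.le.trans (h k))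
  rw [ha] at h1
  exact (ENNReal.div_pos hc0.ne' hC).ne' (le_antisymm h1 zero_le)

/-- If the dilations of a holomorphic function converge in `L¹` of the torus, then its radial
limits exist almost everywhere. -/
theorem hasBoundaryValues_of_tendsto_lintegral {f : (Fin n → ℂ) → ℂ}
    (hf : DifferentiableOn ℂ f (polydisc n)) {F : Torus n → ℂ} (hF : Measurable F)
    (hFi : ∫⁻ ζ, ‖F ζ‖ₑ ∂(torusMeasure n) < ∞)
    (h : Tendsto (fun r : ℝ => ∫⁻ ζ, ‖f ((r : ℂ) • torusPoint ζ) - F ζ‖ₑ ∂(torusMeasure n))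
      (𝓝[<] 1) (𝓝 0)) : HasBoundaryValues f F := by
  set τ : Measure ℝ := volume.restrict (Set.Ioc (-(1 / 2)) (1 / 2)) with hτ
  have hτp : IsProbabilityMeasure τ := ⟨by
    rw [hτ, Measure.restrict_apply_univ, Real.volume_Ioc]; norm_num⟩
  set ψ : ℝ → Torus n := fun t => diagonal n t with hψ
  have hψm : Measurable ψ :=
    (continuous_diagonal.comp (AddCircle.continuous_mk' (1 : ℝ))).measurable
  refine ae_of_ae_ae_add_comp τ hψm (measurableSet_tendsto_radial hf hF) ?_
  obtain ⟨s, hsI, hs1⟩ := exists_seq_Ioo_tendsto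
  have hdm : ∀ k, Measurable fun ζ : Torus n => ‖f ((s k : ℂ) • torusPoint ζ) - F ζ‖ₑ := fun k =>
    ((continuous_comp_real_smul_torusPoint hf (hsI k)).measurable.sub hF).enorm
  set a : ℕ → Torus n → ℝ≥0∞ := fun k ζ =>
    ∫⁻ t, ‖f ((s k : ℂ) • torusPoint (ζ + ψ t)) - F (ζ + ψ t)‖ₑ ∂τ with ha
  have ham : ∀ k, Measurable (a k) := fun k =>
    ((hdm k).comp (measurePreserving_add_comp τ hψm).measurable).lintegral_prod_right'
  -- Fatou's lemma: the slice errors tend to 0 in mean, so their lower limit is 0 almost everywhere.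
  -- This is all that is used, and no subsequence depending on ζ is chosen.
  have hliminf : ∀ᵐ ζ ∂(torusMeasure n), liminf (fun k => a k ζ) atTop = 0 := by
    have h1 : ∫⁻ ζ, liminf (fun k => a k ζ) atTop ∂(torusMeasure n) = 0 := by
      refine le_antisymm ((lintegral_liminf_le ham).trans ?_) zero_le
      have h2 : Tendsto (fun k => ∫⁻ ζ, a k ζ ∂(torusMeasure n)) atTop (𝓝 0) := by
        refine (h.comp hs1).congr fun k => ?_
        exact (lintegral_add_comp τ hψm (hdm k)).symm
      rw [h2.liminf_eq]
    exact (lintegral_eq_zero_iff (Measurable.liminf ham)).1 h1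
  have hfin : ∀ᵐ ζ ∂(torusMeasure n), ∫⁻ t, ‖F (ζ + ψ t)‖ₑ ∂τ < ∞ := by
    refine ae_lt_top ?_ ?_
    · exact (hF.enorm.comp (measurePreserving_add_comp τ hψm).measurable).lintegral_prod_right'
    · rw [lintegral_add_comp τ hψm hF.enorm]
      exact hFi.ne
  filter_upwards [hliminf, hfin] with ζ hζ1 hζ2
  have hFψ : Measurable fun t => F (ζ + ψ t) := hF.comp (measurable_const.add hψm)
  have hint : ∀ b c, IntervalIntegrable (fun t => F (ζ + ψ t)) volume b c := by
    have hper : Function.Periodic (fun t => F (ζ + ψ t)) 1 := by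
      intro t
      simp [hψ]
    refine hper.intervalIntegrable one_ne_zero (t := -(1 / 2)) ?_
    rw [intervalIntegrable_iff_integrableOn_Ioc_of_le (by norm_num),
      show (-(1 / 2) : ℝ) + 1 = 1 / 2 by norm_num]
    exact ⟨hFψ.aestronglyMeasurable, hζ2⟩
  refine ae_restrict_of_ae ?_
  filter_upwards [ae_tendsto_integral_linePoissonKernel_mul hint] with x hx
  refine hx.congr' ?_
  filter_upwards [eventually_Ioo] with r hr
  obtain ⟨C, hC⟩ := isCompact_Icc.exists_bound_of_continuousOn
    (s := Set.Icc (-(1 / 2) : ℝ) (1 / 2)) (continuous_linePoissonKernel hr).continuousOn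
  -- For fixed r the kernel is bounded by C on a period, so the Poisson formula for the dilation by
  -- s k bounds the error by C times the slice error. Letting k → ∞ makes f on the slice the Poisson
  -- integral of F, to which Fatou's theorem applies.
  have hbound : ∀ k, ‖f ((s k : ℂ) • ((r : ℂ) • torusPoint (ζ + ψ x)))
      - ∫ t in (-(1 / 2) : ℝ)..1 / 2, (linePoissonKernel r t : ℂ) * F (ζ + ψ (x + t))‖ₑ
      ≤ ENNReal.ofReal C * a k ζ := by
    intro k
    have hcont : Continuous fun t : ℝ => f ((s k : ℂ) • torusPoint (ζ + ψ (x + t))) :=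
      (continuous_comp_real_smul_torusPoint hf (hsI k)).comp
        (continuous_const.add (continuous_diagonal.comp
          ((AddCircle.continuous_mk' (1 : ℝ)).comp (continuous_const.add continuous_id))))
    have hK : Continuous fun t => (linePoissonKernel r t : ℂ) :=
      Complex.continuous_ofReal.comp (continuous_linePoissonKernel hr)
    have e1 : f ((s k : ℂ) • ((r : ℂ) • torusPoint (ζ + ψ x)))
        = ∫ t in (-(1 / 2) : ℝ)..1 / 2, (linePoissonKernel r t : ℂ) *
          f ((s k : ℂ) • torusPoint (ζ + ψ (x + t))) := by
      rw [← integral_linePoissonKernel_mul_slice hf (hsI k) hr (ζ + ψ x)]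
      simp only [hψ, AddCircle.coe_add, diagonal_add, add_assoc]
    rw [e1, ← intervalIntegral.integral_sub ((hK.fun_mul hcont).intervalIntegrable _ _)
      ((intervalIntegrable_comp_const_add hint x _ _).continuousOn_mul hK.continuousOn),
      intervalIntegral.integral_of_le (by norm_num)]
    refine (enorm_integral_le_lintegral_enorm _).trans ?_
    -- The slice error is an integral over a whole period, hence unchanged by the shift x.
    have e2 : a k ζ = ∫⁻ t in Set.Ioc (-(1 / 2) : ℝ) (1 / 2),
        ‖f ((s k : ℂ) • torusPoint (ζ + ψ (x + t))) - F (ζ + ψ (x + t))‖ₑ := by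
      set E : UnitAddCircle → ℝ≥0∞ := fun b =>
        ‖f ((s k : ℂ) • torusPoint (ζ + diagonal n b)) - F (ζ + diagonal n b)‖ₑ with hE
      have h1 := AddCircle.lintegral_preimage 1 (-(1 / 2)) E
      have h2 := AddCircle.lintegral_preimage 1 (-(1 / 2)) fun b => E ((x : UnitAddCircle) + b)
      rw [lintegral_add_left_eq_self, ← h1, show (-(1 / 2) : ℝ) + 1 = 1 / 2 by norm_num] at h2
      simp only [ha, hτ, hψ, AddCircle.coe_add]
      exact h2.symm
    rw [e2, ← lintegral_const_mul' _ _ (by simp)]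
    refine setLIntegral_mono' measurableSet_Ioc fun t ht => ?_
    rw [← mul_sub, enorm_mul]
    gcongr
    rw [← ofReal_norm, Complex.norm_real]
    exact ENNReal.ofReal_le_ofReal (hC t (Set.Ioc_subset_Icc_self ht))
  have hlim : Tendsto (fun k => ‖f ((s k : ℂ) • ((r : ℂ) • torusPoint (ζ + ψ x)))
      - ∫ t in (-(1 / 2) : ℝ)..1 / 2, (linePoissonKernel r t : ℂ) * F (ζ + ψ (x + t))‖ₑ) atTop
      (𝓝 ‖f ((r : ℂ) • torusPoint (ζ + ψ x))
      - ∫ t in (-(1 / 2) : ℝ)..1 / 2, (linePoissonKernel r t : ℂ) * F (ζ + ψ (x + t))‖ₑ) :=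
    (((tendsto_comp_real_smul hf (smul_torusPoint_mem hr.1 hr.2 _)).comp hs1).sub_const _).enorm
  have hzero : ‖f ((r : ℂ) • torusPoint (ζ + ψ x))
      - ∫ t in (-(1 / 2) : ℝ)..1 / 2, (linePoissonKernel r t : ℂ) * F (ζ + ψ (x + t))‖ₑ = 0 := by
    exact eq_zero_of_tendsto_of_le_mul_of_liminf_eq_zero hlim (by simp) hbound hζ1
  rw [enorm_eq_zero, sub_eq_zero] at hzero
  exact hzero.symm

end Radial

/-! ### Closedness of H² in L² -/

section Closed

variable {n : ℕ}

theorem lintegral_enorm_le_eLpNorm_two {X : Type*} [MeasurableSpace X] {ν : Measure X}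
    [IsProbabilityMeasure ν] {f : X → ℂ} (hf : AEStronglyMeasurable f ν) :
    ∫⁻ x, ‖f x‖ₑ ∂ν ≤ eLpNorm f 2 ν := by
  rw [← eLpNorm_one_eq_lintegral_enorm]
  exact eLpNorm_le_eLpNorm_of_exponent_le (by norm_num) hf

/-- For F in the closure, the candidate is the Cauchy integral f of F. Cauchy and Poisson integrals
agree on H², hence on its closure, so f is both holomorphic and a Poisson integral. Contractivity
then gives the Hardy bound, and approximation by H² gives L¹ convergence of the dilations. -/
theorem isClosed_hardySpace : IsClosed (hardySpace n : Set (Lp ℂ 2 (torusMeasure n))) := by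
  refine isClosed_of_closure_subset fun F hF => ?_
  set f := cauchyTransform (torusMeasure n) F with hf
  have hd : DifferentiableOn ℂ f (polydisc n) :=
    differentiableOn_cauchyTransform (integrable_Lp_two F)
  have hFm : Measurable F := (Lp.stronglyMeasurable F).measurable
  have hP : ∀ z ∈ polydisc n, ∫ ζ, (realPoissonKernel z ζ : ℂ) * F ζ ∂(torusMeasure n) = f z := by
    intro z hz
    have hcl : IsClosed {G : Lp ℂ 2 (torusMeasure n) |
        ∫ ζ, (realPoissonKernel z ζ : ℂ) * G ζ ∂(torusMeasure n)
          = ∫ ζ, cauchyKernel z (torusPoint ζ) * G ζ ∂(torusMeasure n)} :=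
      isClosed_eq (continuous_integral_mul
        (Complex.continuous_ofReal.comp (continuous_realPoissonKernel hz)))
        (continuous_integral_mul (continuous_cauchyKernel_torusPoint hz))
    refine closure_minimal ?_ hcl hF
    intro G hG
    obtain ⟨g, hg, hgG⟩ := mem_hardySpace_iff.1 hG
    rw [Set.mem_ofPred_eq, hg.integral_poissonKernel_mul hgG hz,
      hg.integral_cauchyKernel_mul hgG hz]
  have hcontr : ∀ (G : Torus n → ℂ), Measurable G → ∀ r ∈ Set.Ioo (0 : ℝ) 1,
      ∫⁻ ζ, ‖∫ ξ, (realPoissonKernel ((r : ℂ) • torusPoint ζ) ξ : ℂ) * G ξ ∂(torusMeasure n)‖ₑ ^ 2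
        ∂(torusMeasure n) ≤ ∫⁻ ζ, ‖G ζ‖ₑ ^ 2 ∂(torusMeasure n) := fun G hG r hr =>
    lintegral_sq_enorm_integral_realPoissonKernel_mul_le hr hG
  have hH : MemHardy f := by
    refine ⟨hd, _, lintegral_sq_enorm_lt_top F, fun r h0 h1 => ?_⟩
    refine le_trans (le_of_eq ?_) (hcontr F hFm r ⟨h0, h1⟩)
    exact lintegral_congr fun ζ => by rw [hP _ (smul_torusPoint_mem h0 h1 ζ)]
  refine mem_hardySpace_iff.2 ⟨f, hH, hasBoundaryValues_of_tendsto_lintegral hd hFm ?_ ?_⟩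
  · exact (integrable_Lp_two F).2
  rw [ENNReal.tendsto_nhds_zero]
  intro ε hε
  have hε3 : 0 < ε / 3 := ENNReal.div_pos hε.ne' (by simp)
  obtain ⟨G, hG, hGF⟩ := EMetric.mem_closure_iff.1 hF (ε / 3) hε3
  obtain ⟨g, hg, hgG⟩ := mem_hardySpace_iff.1 hG
  have hGm : Measurable G := (Lp.stronglyMeasurable G).measurable
  have hdist : eLpNorm (fun ζ => F ζ - G ζ) 2 (torusMeasure n) < ε / 3 := by
    rw [Lp.edist_def] at hGF
    exact hGF
  filter_upwards [eventually_Ioo,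
    (hg.tendsto_lintegral_sub hgG).eventually (gt_mem_nhds hε3)] with r hr hr3
  have hcf := continuous_comp_real_smul_torusPoint hd hr
  have hcg := continuous_comp_real_smul_torusPoint hg.1 hr
  have h1 : ∫⁻ ζ, ‖f ((r : ℂ) • torusPoint ζ) - g ((r : ℂ) • torusPoint ζ)‖ₑ ∂(torusMeasure n)
      ≤ ε / 3 := by
    refine (lintegral_enorm_le_eLpNorm_two (hcf.sub hcg).aestronglyMeasurable).trans
      (le_trans ?_ hdist.le)
    rw [← ENNReal.pow_le_pow_left_iff two_ne_zero, eLpNorm_two_sq, eLpNorm_two_sq]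
    refine le_trans (le_of_eq ?_) (hcontr _ (hFm.sub hGm) r hr)
    refine lintegral_congr fun ζ => ?_
    have hz := smul_torusPoint_mem hr.1 hr.2 ζ
    rw [Pi.sub_apply, ← hP _ hz, ← hg.integral_poissonKernel_mul hgG hz, ← integral_sub]
    · simp only [Pi.sub_apply, mul_sub]
    all_goals
      have hk := Complex.continuous_ofReal.comp (continuous_realPoissonKernel hz)
      obtain ⟨C, hC⟩ := isCompact_univ.exists_bound_of_continuousOn hk.continuousOn
      exact (integrable_Lp_two _).bdd_mul (c := C) hk.aestronglyMeasurable
        (Eventually.of_forall fun ζ => hC ζ trivial)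
  have h3 : ∫⁻ ζ, ‖F ζ - G ζ‖ₑ ∂(torusMeasure n) ≤ ε / 3 :=
    (lintegral_enorm_le_eLpNorm_two (hFm.sub hGm).aestronglyMeasurable).trans hdist.le
  have hgGm : Measurable fun ζ => g ((r : ℂ) • torusPoint ζ) - G ζ := hcg.measurable.sub hGm
  calc ∫⁻ ζ, ‖f ((r : ℂ) • torusPoint ζ) - F ζ‖ₑ ∂(torusMeasure n)
      ≤ ∫⁻ ζ, (‖f ((r : ℂ) • torusPoint ζ) - g ((r : ℂ) • torusPoint ζ)‖ₑ
          + (‖g ((r : ℂ) • torusPoint ζ) - G ζ‖ₑ + ‖F ζ - G ζ‖ₑ)) ∂(torusMeasure n) := by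
        refine lintegral_mono fun ζ => ?_
        have e : f ((r : ℂ) • torusPoint ζ) - F ζ
            = (f ((r : ℂ) • torusPoint ζ) - g ((r : ℂ) • torusPoint ζ))
              + ((g ((r : ℂ) • torusPoint ζ) - G ζ) - (F ζ - G ζ)) := by ring
        rw [e]
        exact (enorm_add_le _ _).trans (add_le_add_right enorm_sub_le _)
    _ = _ + (_ + _) := by
        rw [lintegral_add_left (hcf.fun_sub hcg).measurable.enorm,
          lintegral_add_left hgGm.enorm]
    _ ≤ ε / 3 + (ε / 3 + ε / 3) := add_le_add h1 (add_le_add hr3.le h3)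
    _ = ε := by rw [← add_assoc, ENNReal.add_thirds]

end Closed

/-! ### Reproducing kernels and completeness of the model space -/

section ModelSpace

variable {n : ℕ}

theorem HasBoundaryValues.unique {f : (Fin n → ℂ) → ℂ} {F G : Lp ℂ 2 (torusMeasure n)}
    (hF : HasBoundaryValues f F) (hG : HasBoundaryValues f G) : F = G := by
  refine Lp.ext ?_
  filter_upwards [hF, hG] with ζ h1 h2
  exact tendsto_nhds_unique h1 h2

theorem memHardy_of_bounded {f : (Fin n → ℂ) → ℂ} (hf : DifferentiableOn ℂ f (polydisc n)) {B : ℝ}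
    (hB : ∀ z ∈ polydisc n, ‖f z‖ ≤ B) : MemHardy f := by
  refine ⟨hf, ENNReal.ofReal B ^ 2, by simp, fun r h0 h1 => ?_⟩
  calc ∫⁻ ζ, ‖f ((r : ℂ) • torusPoint ζ)‖ₑ ^ 2 ∂(torusMeasure n)
      ≤ ∫⁻ _, ENNReal.ofReal B ^ 2 ∂(torusMeasure n) := by
        refine lintegral_mono fun ζ => ?_
        gcongr
        rw [← ofReal_norm]
        exact ENNReal.ofReal_le_ofReal (hB _ (smul_torusPoint_mem h0 h1 ζ))
    _ = ENNReal.ofReal B ^ 2 := by simp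

/-- A bounded holomorphic function with radial limits almost everywhere has boundary values in
`L²`. -/
theorem exists_hasBoundaryValues {f : (Fin n → ℂ) → ℂ} (hf : DifferentiableOn ℂ f (polydisc n))
    {B : ℝ} (hB : ∀ z ∈ polydisc n, ‖f z‖ ≤ B)
    (h : ∀ᵐ ζ ∂(torusMeasure n), ∃ c : ℂ,
      Tendsto (fun r : ℝ => f ((r : ℂ) • torusPoint ζ)) (𝓝[<] 1) (𝓝 c)) :
    ∃ F : Lp ℂ 2 (torusMeasure n), HasBoundaryValues f F := by
  classical
  set G : Torus n → ℂ := fun ζ => limUnder (𝓝[<] (1 : ℝ)) fun r : ℝ => f ((r : ℂ) • torusPoint ζ)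
  have hG : ∀ᵐ ζ ∂(torusMeasure n),
      Tendsto (fun r : ℝ => f ((r : ℂ) • torusPoint ζ)) (𝓝[<] 1) (𝓝 (G ζ)) := by
    filter_upwards [h] with ζ hζ
    exact tendsto_nhds_limUnder hζ
  -- A sequence of radii makes the limit measurable as a countable limit of continuous functions.
  obtain ⟨s, hsI, hs1⟩ := exists_seq_Ioo_tendsto
  have hGm : AEStronglyMeasurable G (torusMeasure n) := by
    refine aestronglyMeasurable_of_tendsto_ae atTop
      (f := fun k ζ => f ((s k : ℂ) • torusPoint ζ))
      (fun k => (continuous_comp_real_smul_torusPoint hf (hsI k)).aestronglyMeasurable) ?_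
    filter_upwards [hG] with ζ hζ
    exact hζ.comp hs1
  have hGb : ∀ᵐ ζ ∂(torusMeasure n), ‖G ζ‖ ≤ B := by
    filter_upwards [hG] with ζ hζ
    refine le_of_tendsto hζ.norm ?_
    filter_upwards [eventually_Ioo] with r hr
    exact hB _ (smul_torusPoint_mem hr.1 hr.2 ζ)
  have hGp : MemLp G 2 (torusMeasure n) := MemLp.of_bound hGm B hGb
  refine ⟨hGp.toLp G, ?_⟩
  filter_upwards [hG, hGp.coeFn_toLp] with ζ h1 h2
  rw [h2]
  exact h1

theorem exists_bound_cauchyKernel {w : Fin n → ℂ} (hw : w ∈ polydisc n) :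
    ∃ B, ∀ z ∈ closedPolydisc n, ‖cauchyKernel z w‖ ≤ B :=
  isCompact_closedPolydisc.exists_bound_of_continuousOn fun _ hz =>
    (differentiableAt_cauchyKernel hz hw).continuousAt.continuousWithinAt

theorem differentiableOn_cauchyKernel {w : Fin n → ℂ} (hw : w ∈ polydisc n) :
    DifferentiableOn ℂ (fun z => cauchyKernel z w) (polydisc n) := fun _ hz =>
  (differentiableAt_cauchyKernel (polydisc_subset_closedPolydisc hz) hw).differentiableWithinAt

theorem tendsto_cauchyKernel_radial {w : Fin n → ℂ} (hw : w ∈ polydisc n) (ζ : Torus n) :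
    Tendsto (fun r : ℝ => cauchyKernel ((r : ℂ) • torusPoint ζ) w) (𝓝[<] 1)
      (𝓝 (cauchyKernel (torusPoint ζ) w)) := by
  have h1 : Tendsto (fun r : ℝ => (r : ℂ) • torusPoint ζ) (𝓝[<] 1) (𝓝 (torusPoint ζ)) := by
    have : Continuous fun r : ℝ => (r : ℂ) • torusPoint ζ := by fun_prop
    simpa using (this.tendsto 1).mono_left nhdsWithin_le_nhds
  exact (differentiableAt_cauchyKernel (torusPoint_mem_closedPolydisc ζ) hw).continuousAt.tendsto.comp
    h1

variable {I : (Fin n → ℂ) → ℂ}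

/-- The boundary values of an inner function. -/
theorem IsInner.exists_boundary (hI : IsInner I) : ∃ J : Lp ℂ 2 (torusMeasure n),
    HasBoundaryValues I J ∧ ∀ᵐ ζ ∂(torusMeasure n), ‖J ζ‖ = 1 := by
  obtain ⟨J, hJ⟩ := exists_hasBoundaryValues hI.holomorphic
    (fun z hz => (hI.norm_lt_one z hz).le) (hI.unimodular.mono fun ζ ⟨c, _, hc⟩ => ⟨c, hc⟩)
  refine ⟨J, hJ, ?_⟩
  filter_upwards [hJ, hI.unimodular] with ζ h1 ⟨c, hc, h2⟩
  rw [tendsto_nhds_unique h1 h2, hc]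

theorem IsInner.memHardy_mul (hI : IsInner I) {g : (Fin n → ℂ) → ℂ} (hg : MemHardy g) :
    MemHardy fun z => I z * g z := by
  obtain ⟨hd, M, hM, hb⟩ := hg
  refine ⟨hI.holomorphic.fun_mul hd, M, hM, fun r h0 h1 => le_trans ?_ (hb r h0 h1)⟩
  refine lintegral_mono fun ζ => ?_
  have hz := smul_torusPoint_mem h0 h1 ζ
  gcongr
  rw [enorm_mul]
  refine mul_le_of_le_one_left zero_le ?_
  rw [← ofReal_norm]
  exact ENNReal.ofReal_le_one.2 (hI.norm_lt_one _ hz).le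

/-- Multiplication of an `L²` function by a measurable unimodular function. -/
theorem exists_Lp_conj_mul {J F : Lp ℂ 2 (torusMeasure n)}
    (hJ : ∀ᵐ ζ ∂(torusMeasure n), ‖J ζ‖ = 1) :
    ∃ G : Lp ℂ 2 (torusMeasure n), ∀ᵐ ζ ∂(torusMeasure n), G ζ = conj (J ζ) * F ζ := by
  have hm : AEStronglyMeasurable (fun ζ => conj (J ζ) * F ζ) (torusMeasure n) :=
    (Complex.continuous_conj.comp_aestronglyMeasurable (Lp.aestronglyMeasurable J)).mul
      (Lp.aestronglyMeasurable F)
  have hp : MemLp (fun ζ => conj (J ζ) * F ζ) 2 (torusMeasure n) := by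
    refine MemLp.of_le (Lp.memLp F) hm ?_
    filter_upwards [hJ] with ζ hζ
    rw [norm_mul, Complex.norm_conj, hζ, one_mul]
  exact ⟨hp.toLp _, hp.coeFn_toLp⟩

theorem integral_mul_Lp_sub {k : Torus n → ℂ} (hk : Continuous k) (c : ℂ)
    (F G : Lp ℂ 2 (torusMeasure n)) :
    ∫ ζ, (k ζ * F ζ - c * (k ζ * G ζ)) ∂(torusMeasure n)
      = ∫ ζ, k ζ * F ζ ∂(torusMeasure n) - c * ∫ ζ, k ζ * G ζ ∂(torusMeasure n) := by
  obtain ⟨C, hC⟩ := isCompact_univ.exists_bound_of_continuousOn hk.continuousOn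
  have hi : ∀ F : Lp ℂ 2 (torusMeasure n), Integrable (fun ζ => k ζ * F ζ) (torusMeasure n) :=
    fun F => (integrable_Lp_two F).bdd_mul (c := C) hk.aestronglyMeasurable
      (Eventually.of_forall fun ζ => hC ζ trivial)
  rw [integral_sub (hi F) ((hi G).const_mul c), integral_const_mul]

theorem hasBoundaryValues_modelKernel_apply {J K : Lp ℂ 2 (torusMeasure n)}
    (hJ : HasBoundaryValues I J) {w : Fin n → ℂ} (hw : w ∈ polydisc n)
    (hK : HasBoundaryValues (modelKernel I w) K) :
    ∀ᵐ ζ ∂(torusMeasure n), K ζ = (1 - J ζ * conj (I w)) * cauchyKernel (torusPoint ζ) w := by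
  filter_upwards [hJ, hK] with ζ h1 h2
  exact tendsto_nhds_unique h2
    (((h1.mul_const _).const_sub 1).mul (tendsto_cauchyKernel_radial hw ζ))

/-- The pairing with the boundary values of a kernel of the model space. -/
theorem inner_modelKernel_eq {J K F G : Lp ℂ 2 (torusMeasure n)}
    (hJ : HasBoundaryValues I J) {w : Fin n → ℂ} (hw : w ∈ polydisc n)
    (hK : HasBoundaryValues (modelKernel I w) K)
    (hG : ∀ᵐ ζ ∂(torusMeasure n), G ζ = conj (J ζ) * F ζ) :
    ⟪K, F⟫_ℂ = ∫ ζ, cauchyKernel w (torusPoint ζ) * F ζ ∂(torusMeasure n)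
      - I w * ∫ ζ, cauchyKernel w (torusPoint ζ) * G ζ ∂(torusMeasure n) := by
  rw [← integral_mul_Lp_sub (continuous_cauchyKernel_torusPoint hw), L2.inner_def]
  refine integral_congr_ae ?_
  filter_upwards [hasBoundaryValues_modelKernel_apply hJ hw hK, hG] with ζ h1 h2
  rw [h1, h2, RCLike.inner_apply, map_mul, conj_cauchyKernel, map_sub, map_mul, Complex.conj_conj,
    map_one]
  ring

theorem IsInner.differentiableOn_modelKernel (hI : IsInner I) {w : Fin n → ℂ}
    (hw : w ∈ polydisc n) : DifferentiableOn ℂ (modelKernel I w) (polydisc n) :=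
  ((hI.holomorphic.mul_const _).const_sub 1).fun_mul (differentiableOn_cauchyKernel hw)

theorem IsInner.exists_bound_modelKernel (hI : IsInner I) {w : Fin n → ℂ} (hw : w ∈ polydisc n) :
    ∃ B, ∀ z ∈ polydisc n, ‖modelKernel I w z‖ ≤ B := by
  obtain ⟨B, hB⟩ := exists_bound_cauchyKernel hw
  refine ⟨2 * B, fun z hz => ?_⟩
  rw [modelKernel, norm_mul]
  refine mul_le_mul ?_ (hB z (polydisc_subset_closedPolydisc hz)) (norm_nonneg _) zero_le_two
  refine (norm_sub_le _ _).trans ?_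
  rw [norm_one, norm_mul, Complex.norm_conj]
  have := mul_le_mul (hI.norm_lt_one z hz).le (hI.norm_lt_one w hw).le (norm_nonneg _) zero_le_one
  linarith

theorem IsInner.memHardy_modelKernel (hI : IsInner I) {w : Fin n → ℂ} (hw : w ∈ polydisc n) :
    MemHardy (modelKernel I w) :=
  memHardy_of_bounded (hI.differentiableOn_modelKernel hw) (hI.exists_bound_modelKernel hw).choose_spec

theorem IsInner.exists_modelKernel (hI : IsInner I) {w : Fin n → ℂ} (hw : w ∈ polydisc n) :
    ∃ K : modelSpace I, HasBoundaryValues (modelKernel I w) (K : Lp ℂ 2 (torusMeasure n)) := by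
  obtain ⟨J, hJ, hJ1⟩ := hI.exists_boundary
  have hd := hI.differentiableOn_modelKernel hw
  obtain ⟨B, hbd⟩ := hI.exists_bound_modelKernel hw
  obtain ⟨K, hK⟩ := exists_hasBoundaryValues hd hbd (by
    filter_upwards [hJ] with ζ h1
    exact ⟨_, ((h1.mul_const _).const_sub 1).mul (tendsto_cauchyKernel_radial hw ζ)⟩)
  refine ⟨⟨K, mem_hardySpace_iff.2 ⟨_, memHardy_of_bounded hd hbd, hK⟩, ?_⟩, hK⟩
  refine (Submodule.mem_orthogonal' _ _).2 ?_
  rintro F ⟨g, hg, hF⟩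
  obtain ⟨G, hG⟩ := exists_Lp_conj_mul (F := F) hJ1
  -- On the torus |J| = 1, so conj(J) F = F/J, the boundary function of g. Hence both terms of the
  -- pairing with K_w equal I(w) g(w) and cancel.
  have hgG : HasBoundaryValues g G := by
    filter_upwards [hJ, hJ1, hF, hG] with ζ h1 h2 h3 h4
    have hne : J ζ ≠ 0 := by rw [← norm_ne_zero_iff, h2]; exact one_ne_zero
    have h5 : G ζ = F ζ / J ζ := by
      have : J ζ * conj (J ζ) = 1 := by
        rw [Complex.mul_conj, Complex.normSq_eq_norm_sq, h2]; simp
      rw [h4, eq_div_iff hne]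
      linear_combination (F ζ) * this
    rw [h5]
    refine (h3.div h1 hne).congr' ?_
    filter_upwards [h1.eventually_ne hne] with r hr
    exact mul_div_cancel_left₀ _ hr
  rw [inner_modelKernel_eq hJ hw hK hG, (hI.memHardy_mul hg).integral_cauchyKernel_mul hF hw,
    hg.integral_cauchyKernel_mul hgG hw, sub_self]

/-- The reproducing property of the kernels of the model space. -/
theorem IsInner.inner_modelKernel (hI : IsInner I) {w : Fin n → ℂ} (hw : w ∈ polydisc n)
    {K F : modelSpace I} (hK : HasBoundaryValues (modelKernel I w) (K : Lp ℂ 2 (torusMeasure n)))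
    {f : (Fin n → ℂ) → ℂ} (hf : MemHardy f)
    (hF : HasBoundaryValues f (F : Lp ℂ 2 (torusMeasure n))) :
    ⟪K, F⟫_ℂ = f w := by
  obtain ⟨J, hJ, hJ1⟩ := hI.exists_boundary
  obtain ⟨G, hG⟩ := exists_Lp_conj_mul (F := (F : Lp ℂ 2 (torusMeasure n))) hJ1
  obtain ⟨B, hB⟩ := exists_bound_cauchyKernel hw
  have hC : MemHardy fun z => cauchyKernel z w := memHardy_of_bounded
    (differentiableOn_cauchyKernel hw) fun z hz => hB z (polydisc_subset_closedPolydisc hz)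
  obtain ⟨H, hH⟩ := exists_hasBoundaryValues (B := B) (hI.memHardy_mul hC).1 (fun z hz => by
      rw [norm_mul]
      exact (mul_le_of_le_one_left (norm_nonneg _) (hI.norm_lt_one z hz).le).trans
        (hB z (polydisc_subset_closedPolydisc hz))) (by
    filter_upwards [hJ] with ζ h1
    exact ⟨_, h1.mul (tendsto_cauchyKernel_radial hw ζ)⟩)
  have hHF : ⟪H, (F : Lp ℂ 2 (torusMeasure n))⟫_ℂ = 0 :=
    (Submodule.mem_orthogonal _ _).1 F.2.2 H ⟨_, hC, hH⟩
  -- This integral is the inner product of I · C(·, w) with F, which vanishes because F is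
  -- orthogonal to I H².
  have hzero : ∫ ζ, cauchyKernel w (torusPoint ζ) * G ζ ∂(torusMeasure n) = 0 := by
    rw [← hHF, L2.inner_def]
    refine integral_congr_ae ?_
    filter_upwards [hJ, hH, hG] with ζ h1 h2 h3
    rw [h3, tendsto_nhds_unique h2 (h1.mul (tendsto_cauchyKernel_radial hw ζ)),
      RCLike.inner_apply, map_mul, conj_cauchyKernel]
    ring
  rw [Submodule.coe_inner, inner_modelKernel_eq hJ hw hK hG, hzero,
    hf.integral_cauchyKernel_mul hF hw, mul_zero, sub_zero]

/-- An element of the model space orthogonal to the reproducing kernels is zero. -/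
theorem IsInner.eq_zero_of_inner_modelKernel (hI : IsInner I) {F : modelSpace I}
    (h : ∀ w ∈ polydisc n, ∀ K : modelSpace I,
      HasBoundaryValues (modelKernel I w) (K : Lp ℂ 2 (torusMeasure n)) → ⟪K, F⟫_ℂ = 0) :
    F = 0 := by
  obtain ⟨f, hf, hF⟩ := mem_hardySpace_iff.1 F.2.1
  have hf0 : ∀ w ∈ polydisc n, f w = 0 := by
    intro w hw
    obtain ⟨K, hK⟩ := hI.exists_modelKernel hw
    rw [← hI.inner_modelKernel hw hK hf hF, h w hw K hK]
  refine Subtype.ext (Lp.ext ?_)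
  filter_upwards [hF, Lp.coeFn_zero ℂ 2 (torusMeasure n)] with ζ h1 h2
  have h3 : Tendsto (fun r : ℝ => f ((r : ℂ) • torusPoint ζ)) (𝓝[<] 1) (𝓝 0) := by
    refine tendsto_const_nhds.congr' ?_
    filter_upwards [eventually_Ioo] with r hr
    exact (hf0 _ (smul_torusPoint_mem hr.1 hr.2 ζ)).symm
  exact (tendsto_nhds_unique h1 h3).trans h2.symm

theorem isClosed_modelSpace : IsClosed (modelSpace I : Set (Lp ℂ 2 (torusMeasure n))) :=
  isClosed_hardySpace.inter (Submodule.isClosed_orthogonal _)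

instance completeSpace_modelSpace : CompleteSpace (modelSpace I) :=
  isClosed_modelSpace.completeSpace_coe

end ModelSpace

/-! ### Isometries determined by a Gram matrix -/

section Isometry

/-- An isometry can be defined by its values on a family with dense span and a prescribed Gram
matrix. -/
theorem exists_isometry_of_inner_eq {ι M H : Type*} [NormedAddCommGroup M] [InnerProductSpace ℂ M]
    [NormedAddCommGroup H] [InnerProductSpace ℂ H] [CompleteSpace H] {k : ι → M} {v : ι → H}
    (hinner : ∀ i j, ⟪v i, v j⟫_ℂ = ⟪k i, k j⟫_ℂ)
    (hdense : (Submodule.span ℂ (Set.range k)).topologicalClosure = ⊤) :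
    ∃ T : M →L[ℂ] H, (∀ x, ‖T x‖ = ‖x‖) ∧ ∀ i, T (k i) = v i := by
  set e := Finsupp.linearCombination ℂ k
  set f := Finsupp.linearCombination ℂ v
  -- Equal Gram matrices give equal norms for all finite combinations, so the map is well defined on
  -- the span and extends from it by continuity.
  have hnorm : ∀ x, ‖f x‖ = ‖e x‖ := by
    intro x
    have h : ⟪f x, f x⟫_ℂ = ⟪e x, e x⟫_ℂ := by
      simp only [f, e, Finsupp.linearCombination_apply, Finsupp.sum_inner, Finsupp.inner_sum,
        inner_smul_left, inner_smul_right, hinner]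
    rw [← sq_eq_sq₀ (norm_nonneg _) (norm_nonneg _)]
    rw [inner_self_eq_norm_sq_to_K, inner_self_eq_norm_sq_to_K] at h
    exact_mod_cast h
  have he : DenseRange e := by
    have : (Set.range e : Set M) = (LinearMap.range e : Submodule ℂ M) := rfl
    rw [DenseRange, this, Finsupp.range_linearCombination]
    exact Submodule.dense_iff_topologicalClosure_eq_top.2 hdense
  have hT := LinearMap.extendOfNorm_eq (f := f) he ⟨1, fun x => by rw [one_mul, hnorm x]⟩
  refine ⟨f.extendOfNorm e, fun x => ?_, fun i => ?_⟩
  · refine he.induction_on (p := fun x => ‖f.extendOfNorm e x‖ = ‖x‖) x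
      (isClosed_eq (by fun_prop) (by fun_prop)) fun y => ?_
    rw [hT, hnorm]
  · have := hT (Finsupp.single i 1)
    simpa [e, f] using this

end Isometry

/-! ### Existence of the Clark operator -/

section ClarkOperator

variable {n : ℕ} {I : (Fin n → ℂ) → ℂ}

/-- The function `ξ ↦ C(ξ, w)` in `L²(σ)`. -/
theorem exists_Lp_cauchyKernel (σ : Measure (Torus n)) [IsFiniteMeasure σ] {w : Fin n → ℂ}
    (hw : w ∈ polydisc n) :
    ∃ c : Lp ℂ 2 σ, ∀ᵐ ξ ∂σ, c ξ = cauchyKernel (torusPoint ξ) w :=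
  ⟨ContinuousMap.toLp 2 σ ℂ ⟨_, continuous_cauchyKernel_torusPoint' hw⟩,
    ContinuousMap.coeFn_toLp σ _⟩

/-- C(w, ξ) is the conjugate of C(ξ, w). This translates vanishing of the Cauchy transform into
orthogonality to the kernels. -/
theorem inner_eq_cauchyTransform {σ : Measure (Torus n)} {w : Fin n → ℂ} {a : ℂ} {c f : Lp ℂ 2 σ}
    (hc : ∀ᵐ ξ ∂σ, c ξ = a * cauchyKernel (torusPoint ξ) w) :
    ⟪c, f⟫_ℂ = conj a * cauchyTransform σ f w := by
  rw [L2.inner_def, cauchyTransform, ← integral_const_mul]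
  refine integral_congr_ae ?_
  filter_upwards [hc] with ξ h
  rw [h, RCLike.inner_apply, map_mul, conj_cauchyKernel]
  ring

theorem one_sub_mul_conj_inner_ne_zero (hI : IsInner I) (α : Circle) {w : Fin n → ℂ}
    (hw : w ∈ polydisc n) : 1 - (α : ℂ) * conj (I w) ≠ 0 := by
  have h := one_sub_mul_conj_ne_zero (hI.norm_lt_one w hw) (Circle.norm_coe α).le
  rw [← map_ne_zero (starRingEnd ℂ)] at h
  simpa [mul_comm] using h

theorem isClarkOperator_clarkOperator (hI : IsInner I) (α : Circle) :
    IsClarkOperator I α (clarkOperator I α) := by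
  have hσ := isClarkMeasure_clarkMeasure hI α
  have hfin : IsFiniteMeasure (clarkMeasure I α) := hσ.1
  have hex : ∃ T, IsClarkOperator I α T := by
    choose K hK using fun w : polydisc n => hI.exists_modelKernel w.2
    choose c hc using fun w : polydisc n => exists_Lp_cauchyKernel (clarkMeasure I α) w.2
    set v : polydisc n → Lp ℂ 2 (clarkMeasure I α) :=
      fun w => (1 - (α : ℂ) * conj (I w)) • c w with hv
    have hv' : ∀ w : polydisc n, ∀ᵐ ξ ∂(clarkMeasure I α),
        v w ξ = (1 - (α : ℂ) * conj (I w)) * cauchyKernel (torusPoint ξ) w := by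
      intro w
      filter_upwards [hc w, Lp.coeFn_smul (1 - (α : ℂ) * conj (I w)) (c w)] with ξ h1 h2
      rw [hv, h2, Pi.smul_apply, h1, smul_eq_mul]
    have hinner : ∀ i j, ⟪v i, v j⟫_ℂ = ⟪K i, K j⟫_ℂ := by
      intro i j
      rw [hI.inner_modelKernel i.2 (hK i) (hI.memHardy_modelKernel j.2) (hK j),
        inner_eq_cauchyTransform (hv' i),
        ← integral_cauchyKernel_mul_clark hI hσ i.2 j.2, cauchyTransform]
      have e : ∫ ξ, cauchyKernel i (torusPoint ξ) * v j ξ ∂(clarkMeasure I α)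
          = (1 - (α : ℂ) * conj (I j)) *
            ∫ ξ, cauchyKernel i (torusPoint ξ) * cauchyKernel (torusPoint ξ) j
              ∂(clarkMeasure I α) := by
        rw [← integral_const_mul]
        refine integral_congr_ae ?_
        filter_upwards [hv' j] with ξ h
        rw [h]
        ring
      rw [e]
      simp only [map_sub, map_one, map_mul, Complex.conj_conj]
      ring
    -- Completeness of the model space enters here: density follows from a trivial orthogonal
    -- complement.
    have hdense : (Submodule.span ℂ (Set.range K)).topologicalClosure = ⊤ := by
      rw [Submodule.topologicalClosure_eq_top_iff, Submodule.eq_bot_iff]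
      intro F hF
      refine hI.eq_zero_of_inner_modelKernel fun w hw K' hK' => ?_
      have : K' = K ⟨w, hw⟩ := Subtype.ext (hK'.unique (hK ⟨w, hw⟩))
      rw [this]
      exact (Submodule.mem_orthogonal _ _).1 hF _ (Submodule.subset_span ⟨_, rfl⟩)
    obtain ⟨T, hT1, hT2⟩ := exists_isometry_of_inner_eq hinner hdense
    exact ⟨T, hT1, fun w hw => ⟨K ⟨w, hw⟩, hK ⟨w, hw⟩, by rw [hT2]; exact hv' ⟨w, hw⟩⟩⟩
  rw [clarkOperator, dif_pos hex]
  exact hex.choose_spec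

end ClarkOperator

/-! ### Density of the polydisc algebra -/

section PolydiscAlgebra

variable {n : ℕ}

theorem MemPolydiscAlgebra.zero : MemPolydiscAlgebra (fun _ : Fin n → ℂ => (0 : ℂ)) :=
  ⟨continuousOn_const, differentiableOn_const _⟩

theorem memPolydiscAlgebra_cauchyKernel {w : Fin n → ℂ} (hw : w ∈ polydisc n) :
    MemPolydiscAlgebra fun z => cauchyKernel z w :=
  ⟨fun _ hz => (differentiableAt_cauchyKernel hz hw).continuousAt.continuousWithinAt,
    differentiableOn_cauchyKernel hw⟩

/-- The polydisc algebra as a subspace of `L²(σ)`. -/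
def polydiscAlgebraSubmodule (σ : Measure (Torus n)) : Submodule ℂ (Lp ℂ 2 σ) where
  carrier := polydiscAlgebraL2 σ
  zero_mem' := ⟨_, MemPolydiscAlgebra.zero, Lp.coeFn_zero ℂ 2 σ⟩
  add_mem' := by
    rintro F G ⟨f, hf, hF⟩ ⟨g, hg, hG⟩
    refine ⟨fun z => f z + g z, ⟨hf.1.add hg.1, hf.2.add hg.2⟩, ?_⟩
    filter_upwards [hF, hG, Lp.coeFn_add F G] with ξ h1 h2 h3
    rw [h3, Pi.add_apply, h1, h2]
  smul_mem' := by
    rintro c F ⟨f, hf, hF⟩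
    refine ⟨fun z => c * f z, ⟨continuousOn_const.mul hf.1, hf.2.const_mul c⟩, ?_⟩
    filter_upwards [hF, Lp.coeFn_smul c F] with ξ h1 h3
    rw [h3, Pi.smul_apply, h1, smul_eq_mul]

theorem continuous_cauchyKernel_smul_torusPoint {r : ℝ} (hr : r ∈ Set.Ioo (0 : ℝ) 1) :
    Continuous fun p : Torus n × Torus n =>
      cauchyKernel ((r : ℂ) • torusPoint p.1) (torusPoint p.2) := by
  have hc : ∀ j, Continuous fun ζ : Torus n => torusPoint ζ j := fun j =>
    (continuous_apply j).comp continuous_torusPoint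
  refine continuous_finsetProd _ fun j _ => continuous_const.div ?_ fun p => ?_
  · exact continuous_const.sub ((((hc j).comp continuous_fst).const_smul (r : ℂ)).mul
      (Complex.continuous_conj.comp ((hc j).comp continuous_snd)))
  · exact one_sub_mul_conj_ne_zero (smul_torusPoint_mem hr.1 hr.2 _ j)
      (norm_torusPoint_apply _ _).le

/-- If the Cauchy transform of `f σ` vanishes then `f` is orthogonal to the dilations of holomorphic
functions. -/
theorem integral_conj_mul_eq_zero_of_cauchyTransform {σ : Measure (Torus n)} [IsFiniteMeasure σ]
    {f : Torus n → ℂ} (hf : Integrable f σ) (h0 : ∀ z ∈ polydisc n, cauchyTransform σ f z = 0)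
    {g : (Fin n → ℂ) → ℂ} (hg : DifferentiableOn ℂ g (polydisc n)) {r : ℝ}
    (hr : r ∈ Set.Ioo (0 : ℝ) 1) :
    ∫ ξ, conj (g ((r : ℂ) • ((r : ℂ) • torusPoint ξ))) * f ξ ∂σ = 0 := by
  -- The two factors r play different roles: one makes g(r ·) holomorphic near the closed polydisc,
  -- the other moves ξ inside, where the Cauchy formula holds. The second factor is then transferred
  -- from ξ to ζ in the kernel, so that integrating in ξ first gives the Cauchy transform at rζ.
  have h1 : ∀ ξ : Torus n, conj (g ((r : ℂ) • ((r : ℂ) • torusPoint ξ)))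
      = ∫ ζ, cauchyKernel ((r : ℂ) • torusPoint ζ) (torusPoint ξ) *
        conj (g ((r : ℂ) • torusPoint ζ)) ∂(torusMeasure n) := by
    intro ξ
    rw [← integral_cauchyKernel_mul (DifferentiableOn.comp_real_smul hg hr)
      (smul_torusPoint_mem hr.1 hr.2 ξ), ← integral_conj]
    refine integral_congr_ae (Eventually.of_forall fun ζ => ?_)
    simp only [map_mul, conj_cauchyKernel]
    congr 1
    refine Finset.prod_congr rfl fun j _ => ?_
    simp only [Pi.smul_apply, smul_eq_mul, map_mul, Complex.conj_ofReal]
    ring_nf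
  have hk : Continuous fun p : Torus n × Torus n =>
      cauchyKernel ((r : ℂ) • torusPoint p.2) (torusPoint p.1) *
        conj (g ((r : ℂ) • torusPoint p.2)) :=
    ((continuous_cauchyKernel_smul_torusPoint hr).comp continuous_swap).mul
      (Complex.continuous_conj.comp
        ((continuous_comp_real_smul_torusPoint hg hr).comp continuous_snd))
  obtain ⟨C, hC⟩ := isCompact_univ.exists_bound_of_continuousOn hk.continuousOn
  have hint : Integrable (Function.uncurry fun ξ ζ : Torus n =>
      cauchyKernel ((r : ℂ) • torusPoint ζ) (torusPoint ξ) *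
        conj (g ((r : ℂ) • torusPoint ζ)) * f ξ) (σ.prod (torusMeasure n)) :=
    (hf.comp_fst (torusMeasure n)).bdd_mul (c := C) hk.aestronglyMeasurable
      (Eventually.of_forall fun p => hC p trivial)
  simp only [h1, ← integral_mul_const]
  rw [integral_integral_swap hint]
  refine integral_eq_zero_of_ae (Eventually.of_forall fun ζ => ?_)
  have h2 := h0 _ (smul_torusPoint_mem hr.1 hr.2 ζ)
  rw [cauchyTransform] at h2
  have h3 : ∀ ξ : Torus n, cauchyKernel ((r : ℂ) • torusPoint ζ) (torusPoint ξ) *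
      conj (g ((r : ℂ) • torusPoint ζ)) * f ξ = conj (g ((r : ℂ) • torusPoint ζ)) *
      (cauchyKernel ((r : ℂ) • torusPoint ζ) (torusPoint ξ) * f ξ) := fun ξ => by ring
  simp only [h3]
  rw [integral_const_mul, h2, mul_zero, Pi.zero_apply]

theorem inner_eq_zero_of_cauchyTransform {σ : Measure (Torus n)} [IsFiniteMeasure σ]
    {f : Lp ℂ 2 σ} (h0 : ∀ z ∈ polydisc n, cauchyTransform σ f z = 0) {G : Lp ℂ 2 σ}
    (hG : G ∈ polydiscAlgebraL2 σ) : ⟪G, f⟫_ℂ = 0 := by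
  obtain ⟨g, ⟨hgc, hgd⟩, hgG⟩ := hG
  have h1 : ⟪G, f⟫_ℂ = ∫ ξ, conj (g (torusPoint ξ)) * f ξ ∂σ := by
    rw [L2.inner_def]
    refine integral_congr_ae ?_
    filter_upwards [hgG] with ξ h
    rw [h, RCLike.inner_apply, mul_comm]
  obtain ⟨B, hB⟩ := isCompact_closedPolydisc.exists_bound_of_continuousOn hgc
  have hmem : ∀ r ∈ Set.Ioo (0 : ℝ) 1, ∀ ξ : Torus n,
      (r : ℂ) • ((r : ℂ) • torusPoint ξ) ∈ polydisc n := fun r hr ξ =>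
    real_smul_mem_polydisc hr
      (polydisc_subset_closedPolydisc (smul_torusPoint_mem hr.1 hr.2 ξ))
  have hlim : Tendsto (fun r : ℝ => ∫ ξ, conj (g ((r : ℂ) • ((r : ℂ) • torusPoint ξ))) * f ξ ∂σ)
      (𝓝[<] 1) (𝓝 (∫ ξ, conj (g (torusPoint ξ)) * f ξ ∂σ)) := by
    refine tendsto_integral_filter_of_dominated_convergence (fun ξ => B * ‖f ξ‖) ?_ ?_
      ((integrable_Lp_two f).norm.const_mul B) ?_
    · filter_upwards [eventually_Ioo] with r hr
      refine (Continuous.aestronglyMeasurable ?_).mul (Lp.aestronglyMeasurable f)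
      exact Complex.continuous_conj.comp (hgd.continuousOn.comp_continuous
        ((continuous_torusPoint.const_smul (r : ℂ)).const_smul (r : ℂ)) (hmem r hr))
    · filter_upwards [eventually_Ioo] with r hr
      refine Eventually.of_forall fun ξ => ?_
      rw [norm_mul, Complex.norm_conj]
      gcongr
      exact hB _ (polydisc_subset_closedPolydisc (hmem r hr ξ))
    · refine Eventually.of_forall fun ξ => Tendsto.mul_const _
        ((Complex.continuous_conj.tendsto _).comp
          ((hgc _ (torusPoint_mem_closedPolydisc ξ)).tendsto.comp ?_))
      refine tendsto_nhdsWithin_iff.2 ⟨?_, ?_⟩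
      · have : Continuous fun r : ℝ => (r : ℂ) • ((r : ℂ) • torusPoint ξ) := by fun_prop
        simpa using (this.tendsto 1).mono_left nhdsWithin_le_nhds
      · filter_upwards [eventually_Ioo] with r hr
        exact polydisc_subset_closedPolydisc (hmem r hr ξ)
  rw [h1]
  refine tendsto_nhds_unique hlim (tendsto_const_nhds.congr' ?_)
  filter_upwards [eventually_Ioo] with r hr
  exact (integral_conj_mul_eq_zero_of_cauchyTransform (integrable_Lp_two f) h0 hgd hr).symm

/-- The polydisc algebra is dense in `L²(σ)` if and only if the Cauchy transform is injective. -/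
theorem dense_polydiscAlgebraL2_iff (σ : Measure (Torus n)) [IsFiniteMeasure σ] :
    Dense (polydiscAlgebraL2 σ) ↔
      ∀ f : Lp ℂ 2 σ, f ≠ 0 → ∃ z ∈ polydisc n, cauchyTransform σ f z ≠ 0 := by
  have h : Dense (polydiscAlgebraL2 σ) ↔ (polydiscAlgebraSubmodule σ)ᗮ = ⊥ := by
    rw [← Submodule.topologicalClosure_eq_top_iff, ← Submodule.dense_iff_topologicalClosure_eq_top]
    rfl
  rw [h, Submodule.eq_bot_iff]
  constructor
  · intro h f hf
    by_contra! h0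
    exact hf (h f ((Submodule.mem_orthogonal _ _).2 fun G hG =>
      inner_eq_zero_of_cauchyTransform h0 hG))
  · intro h f hf
    by_contra hne
    obtain ⟨z, hz, hne⟩ := h f hne
    obtain ⟨c, hc⟩ := exists_Lp_cauchyKernel σ hz
    refine hne ?_
    have h1 := (Submodule.mem_orthogonal _ _).1 hf c ⟨_, memPolydiscAlgebra_cauchyKernel hz, hc⟩
    rwa [inner_eq_cauchyTransform (a := 1) (by simpa using hc), map_one, one_mul] at h1

end PolydiscAlgebra

/-! ### Unitarity of the Clark operator -/

section Unitary

variable {n : ℕ} {I : (Fin n → ℂ) → ℂ}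

/-- The Clark operator is unitary if and only if the Cauchy transform is injective. -/
theorem clarkOperator_unitary_iff (hI : IsInner I) (α : Circle) :
    (∃ U : modelSpace I ≃ₗᵢ[ℂ] Lp ℂ 2 (clarkMeasure I α), ∀ F, U F = clarkOperator I α F) ↔
      ∀ f : Lp ℂ 2 (clarkMeasure I α), f ≠ 0 →
        ∃ z ∈ polydisc n, cauchyTransform (clarkMeasure I α) f z ≠ 0 := by
  obtain ⟨hnorm, hker⟩ := isClarkOperator_clarkOperator hI α
  constructor
  · rintro ⟨U, hU⟩ f hf
    by_contra! h0
    have : U.symm f = 0 := by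
      refine hI.eq_zero_of_inner_modelKernel fun w hw K hK => ?_
      obtain ⟨K', hK', hTK⟩ := hker w hw
      obtain rfl : K = K' := Subtype.ext (hK.unique hK')
      rw [← U.inner_map_map, U.apply_symm_apply, hU, inner_eq_cauchyTransform hTK, h0 w hw,
        mul_zero]
    exact hf (by simpa using this)
  · intro h
    set T : modelSpace I →ₗᵢ[ℂ] Lp ℂ 2 (clarkMeasure I α) :=
      ⟨(clarkOperator I α).toLinearMap, hnorm⟩ with hT
    -- The isometric image of a complete space is closed, so surjectivity reduces to a trivial
    -- orthogonal complement.
    have hclosed : IsClosed (LinearMap.range T.toLinearMap : Set (Lp ℂ 2 (clarkMeasure I α))) := by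
      have := T.isometry.isClosedEmbedding.isClosed_range
      exact this
    have hcomplete : CompleteSpace (LinearMap.range T.toLinearMap) :=
      hclosed.completeSpace_coe
    have hrange : LinearMap.range T.toLinearMap = ⊤ := by
      rw [← Submodule.orthogonal_eq_bot_iff, Submodule.eq_bot_iff]
      intro f hf
      by_contra hne
      obtain ⟨w, hw, hne⟩ := h f hne
      obtain ⟨K, hK, hTK⟩ := hker w hw
      have h1 := (Submodule.mem_orthogonal _ _).1 hf (clarkOperator I α K) ⟨K, rfl⟩
      rw [inner_eq_cauchyTransform hTK, mul_eq_zero, map_eq_zero] at h1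
      -- The scalar in the image of K_w is nonzero because |I(w)| < 1 = |α|; orthogonality to that
      -- image therefore forces the Cauchy transform to vanish at w.
      exact h1.elim (one_sub_mul_conj_inner_ne_zero hI α hw) hne
    exact ⟨LinearIsometryEquiv.ofSurjective T (LinearMap.range_eq_top.1 hrange), fun F => rfl⟩

end Unitary

end PolydiscClark

theorem theorem3p2 {n : ℕ} (hn : 2 ≤ n) (I : (Fin n → ℂ) → ℂ) (hI : IsInner I) (α : Circle) :
    List.TFAE [
      -- the operator is unitary
      ∃ U : modelSpace I ≃ₗᵢ[ℂ] Lp ℂ 2 (clarkMeasure I α), ∀ F, U F = clarkOperator I α F,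
      -- the Cauchy transform of `f σ` is not identically zero for nonzero `f`
      ∀ f : Lp ℂ 2 (clarkMeasure I α), f ≠ 0 →
        ∃ z ∈ polydisc n, cauchyTransform (clarkMeasure I α) f z ≠ 0,
      -- the polydisc algebra is dense
      Dense (polydiscAlgebraL2 (clarkMeasure I α))] := by
  have hfin : IsFiniteMeasure (clarkMeasure I α) := (isClarkMeasure_clarkMeasure hI α).1
  tfae_have 1 ↔ 2 := clarkOperator_unitary_iff hI α
  tfae_have 3 ↔ 2 := dense_polydiscAlgebraL2_iff _
  tfae_finish
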